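/- Let $d\ge 2$ be an integer and $0<\alpha<1$. Let $\mathbb B$ be the regular $d$-ary rooted tree (every vertex has $d$ children), write $|x|$ for the distance of $x$ from the root, $\mathbb B(n)=\{x\in\mathbb B:|x|=n\}$, and $y\le x$ if $y$ lies on the path from the root to $x$ (both ends included). Let $(U_x)_{x\in\mathbb B}$ be i.i.d. exponential random variables with mean $1$ on a probability space $(\Omega,\mathcal F,\mathbb P)$, and put $$T(x)=\sum_{y\le x}\alpha^{|y|}U_y,\qquad C(t)=\{x\in\mathbb B: T(x)\le t\}\quad(0\le t\le\infty),$$ $$C(t-)=\bigcup_{0\le r<t}C(r)\quad(\text{so } C(0-)=\emptyset),\qquad T(\infty)=\lim_{n\to\infty}\inf\{t\ge 0:\#C(t)=n\}\in[0,\infty],$$ where the limit exists almost surely, as the infima increase with $n$ almost surely. Write $s(\alpha)=\prod_{k=1}^\infty(1-\alpha^k)^{-1}$ and, for $\gamma\ge 1$, $$c_{4.1}(\alpha,d)=\lim_{t\to\infty}e^t\,\mathbb P(T(\infty)>t),\qquad c_{4.2}(\alpha,\gamma,d)=\frac{d^2}{d-1}(1-\alpha)\,s(\alpha)^2\exp\Big(\frac{\frac12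 d(d-1)-1}{\gamma(1-\alpha)}\Big),$$ $$c_{4.3}(\alpha,d)=c_{4.1}(\alpha,d)^d\,c_{4.2}(\alpha,d-\alpha,d)\,(1-\alpha)^{-1}.$$ **Theorem 4.4.** The limit defining $c_{4.1}(\alpha,d)$ exists and is finite, and the following hold. (a) For all $0\le\delta\le t$ and all integers $n\ge 0$, $$\mathbb E\big(\#\big((C(t)\setminus C((t-\delta)-))\cap\mathbb B(n)\big)\,\big|\,T(\infty)>t\big)\le c_{4.1}(\alpha,d)^d\,c_{4.2}(\alpha,d-\alpha,d)\,(\alpha^{n+1}\wedge\delta).$$ (b) For all $0\le\delta\le t$, $$\mathbb E\big(\#(C(t)\setminus C((t-\delta)-))\,\big|\,T(\infty)>t\big)\le c_{4.1}(\alpha,d)^d\,c_{4.2}(\alpha,d-\alpha,d)\,(1-\alpha)^{-1}\big(\log^+(1/\delta)+1\big)(\delta\wedge 1)\le c_{4.3}(\alpha,d),$$ where the middle expression is read as $0$ when $\delta=0$. In particular $\mathbb E(\#C(t)\,|\,T(\infty)>t)\le c_{4.3}(\alpha,d)$ for all $t\ge 0$. (c) For all $t\ge 0$ and all integers $n\ge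 0$, $$\mathbb E\big(\#(C(t\wedge T(\infty))\cap\mathbb B(n))\big)\le c_{4.3}(\alpha,d)\,(1-e^{-t}).$$ -/

import Mathlib

open MeasureTheory ProbabilityTheory Filter Topology

noncomputable section

namespace TreeDLA

/-- Vertices of the regular `d`-ary rooted tree `𝔹`: finite words over `d` letters. The root is
the empty word, the children of `x` are the words `x ++ [i]`, and the ancestors of `x`
(including `x`) are the words `x.take j` with `j ≤ x.length`. -/
abbrev Vertex (d : ℕ) : Type := List (Fin d)

/-- `𝔹(n)`, the vertices at distance `n` from the root. -/
def level (d n : ℕ) : Set (Vertex d) := {x | x.length = n}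

variable {d : ℕ}

/-- The percolation time `T(x) = ∑_{y ≤ x} α ^ |y| U_y`, the sum being over the ancestors `y` of
`x`, including the root and `x` itself. -/
def passageTime (α : ℝ) (u : Vertex d → ℝ) (x : Vertex d) : ℝ :=
  ∑ j ∈ Finset.range (x.length + 1), α ^ j * u (x.take j)

/-- The cluster `C(s) = {x : T(x) ≤ s}` of vertices wet at time `s`, where `s` may be infinite. -/
def cluster (α : ℝ) (u : Vertex d → ℝ) (s : EReal) : Set (Vertex d) :=
  {x | (passageTime α u x : EReal) ≤ s}

/-- The left limit `C(s-)`, the union of the `C(r)` over `0 ≤ r < s`; in particular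
`C(0-) = ∅`. -/
def clusterLeft (α : ℝ) (u : Vertex d → ℝ) (s : ℝ) : Set (Vertex d) :=
  ⋃ r ∈ Set.Ico (0 : ℝ) s, cluster α u (r : EReal)

/-- The first time `inf {s ≥ 0 : #C(s) = n}` at which exactly `n` vertices are wet
(`⊤` if there is no such time). -/
def fillTime (α : ℝ) (u : Vertex d → ℝ) (n : ℕ) : EReal :=
  sInf {s : EReal | 0 ≤ s ∧ (cluster α u s).encard = (n : ℕ∞)}

/-- The time `T(∞)` to percolate to infinity: the limit of the times at which `n` vertices are
wet. These times increase with `n` whenever the weights `u` are positive and the percolation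
times are pairwise distinct (almost surely, for exponential weights), and their limit is then
their supremum. -/
def explosionTime (α : ℝ) (u : Vertex d → ℝ) : EReal := ⨆ n : ℕ, fillTime α u n

instance isProbabilityMeasure_exp_one : IsProbabilityMeasure (expMeasure 1) :=
  isProbabilityMeasure_expMeasure one_pos

/-- The law of an i.i.d. family of mean one exponential variables indexed by the vertices. -/
def weightLaw (d : ℕ) : Measure (Vertex d → ℝ) :=
  Measure.infinitePi fun _ : Vertex d => expMeasure 1

/-- The constant `lim_{t → ∞} e ^ t P(T(∞) > t)`. -/
def tailConst (α : ℝ) (d : ℕ) : ℝ :=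
  limUnder atTop fun t : ℝ =>
    Real.exp t * (weightLaw d).real {u | (t : EReal) < explosionTime α u}

/-- `s(α) = ∏_{k ≥ 1} (1 - α ^ k)⁻¹`. -/
def eulerProd (α : ℝ) : ℝ := ∏' k : ℕ, (1 - α ^ (k + 1))⁻¹

/-- The product that defines `s(α)` converges. -/
theorem multipliable_eulerProd {α : ℝ} (h0 : 0 < α) (h1 : α < 1) :
    Multipliable fun k : ℕ => (1 - α ^ (k + 1))⁻¹ := by
  have hpow : ∀ k : ℕ, α ^ (k + 1) ≤ α := fun k =>
    pow_le_of_le_one h0.le h1.le (Nat.succ_ne_zero k)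
  have hsum : Summable fun k : ℕ => (1 - α ^ (k + 1))⁻¹ - 1 := by
    refine Summable.of_nonneg_of_le (fun k => ?_) (fun k => ?_)
      ((summable_geometric_of_lt_one h0.le h1).mul_left ((1 - α)⁻¹))
    · have := hpow k
      have h2 : 0 < α ^ (k + 1) := by positivity
      rw [sub_nonneg, one_le_inv₀ (by linarith)]
      linarith
    · have h3 := hpow k
      have h4 : 0 < 1 - α ^ (k + 1) := by linarith
      have h5 : 0 < α ^ k := by positivity
      have h6 : α ^ (k + 1) ≤ α ^ k := pow_le_pow_of_le_one h0.le h1.le (Nat.le_succ k)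
      have h7 : (1 - α ^ (k + 1))⁻¹ - 1 = (1 - α ^ (k + 1))⁻¹ * α ^ (k + 1) := by
        field_simp
        ring
      rw [h7]
      exact mul_le_mul (inv_anti₀ (by linarith) (by linarith)) h6 (by positivity)
        (inv_nonneg.mpr (by linarith))
  simpa using Real.multipliable_one_add_of_summable hsum

/-- The constant
`d² (d - 1)⁻¹ (1 - α) s(α)² exp (d₀ / (γ (1 - α)))`, where `d₀ = d (d - 1) / 2 - 1`. -/
def laplaceConst (α γ : ℝ) (d : ℕ) : ℝ :=
  (d : ℝ) ^ 2 * ((d : ℝ) - 1)⁻¹ * (1 - α) * eulerProd α ^ 2 *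
    Real.exp (((d : ℝ) * ((d : ℝ) - 1) / 2 - 1) / (γ * (1 - α)))

/-- The constant in the bound for a single level. -/
def levelConst (α : ℝ) (d : ℕ) : ℝ :=
  tailConst α d ^ d * laplaceConst α ((d : ℝ) - α) d

/-- The constant in the bound for the whole cluster. -/
def clusterConst (α : ℝ) (d : ℕ) : ℝ := levelConst α d * (1 - α)⁻¹

/-- The number of elements of a set, as an extended nonnegative real. -/
def size (A : Set (Vertex d)) : ENNReal := (A.encard : ENNReal)

end TreeDLA

end

/-!
Write `F(t) = P(T(∞) > t)` (`survival`) and condition on the root weight. The subtrees above the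
children of the root are independent rescaled copies of the whole tree, so `F` satisfies the
renewal equation `F(t) = E F((t - U) / α) ^ d` (`survival_eq`). It follows that `exp t * F t` is
increasing, that is, the hazard rate of `T(∞)` is at most one, and, with an a priori exponential
bound on `F`, that `exp t * F t` converges (`tendsto_tailConst`).

The expected number of vertices of level `n` that get wet in a window `t + W`, on the event that
`T(∞) > t`, is controlled by comparing it with the *deficit*
`D_n(t) = F(t) - E F(t + α ^ n E) = P(t < T(∞) ≤ t + α ^ n E)`, where `E` is an independent
exponential clock with rate `d`.

* The probability that a given vertex of level `n + 1` gets wet in the window while `T(∞) > t` is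
  `E [F(R) ^ (d - 1) h_n(R)]` with `R = (t - U) / α`, where `h_n` is the same probability, for the
  rescaled window, in the subtree that contains the vertex (`hitProb_cons`).
* The deficit satisfies
  `D_(n + 1)(t) ≥ (d + α ^ n) / (1 + α ^ n) * E [F(R) ^ (d - 1) D_n(R)]` (`deficit_succ_ge`). This
  is the heart of the matter: integrating by parts against the density of the clock and using
  that the hazard rate is at most one, the deficit of `F ^ d` is compared with that of `F`
  (`pow_sub_integral_pow_ge`).
* Hence a bound at the root by `M * D_0(t) / D_0(0)` gives the bound
  `M * ∏ (1 + α ^ j) / (d + α ^ j) * D_n(t) / D_0(0)` for each vertex of level `n`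
  (`hitProb_le_deficit`). As there are `d ^ n` such vertices and the hazard rate bound gives
  `D_n(t) ≤ α ^ n / d * F(t)`, the sum over level `n` is at most a constant times
  `M * α ^ n * F(t)`.
* A lower bound for `D_0(0)`, which is the Laplace transform of `T(∞)` at `d`, comes from the path
  that always follows the child with the smallest weight (`one_le_mul_deficit_zero`). The
  resulting constant is at most `laplaceConst α (d - α) d` (`two_mul_sq_le_laplaceConst`).

At the root, `D_0(t) / D_0(0)` is explicit for `t ≤ 0` and at least `exp (-t)` for `t ≥ 0`, so the
comparison only involves the exponential density and the tail bound `F(t) ≤ c exp (-t)`. Windows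
`[t - δ, t]` give the bound for one level given `T(∞) > t`, and summation over the levels the bound
for the whole cluster. Cutting `[0, t]` into short windows `(s, s + δ]`, each with the event
`T(∞) > s`, and letting `δ → 0` gives the bound for the cluster at the time `t ∧ T(∞)`.
-/

noncomputable section

namespace TreeDLA

variable {d : ℕ}

/-! ### The root decomposition of the weights -/

instance isProbabilityMeasure_weightLaw : IsProbabilityMeasure (weightLaw d) := by
  unfold weightLaw
  infer_instance

/-- The weights with root weight `p.1` whose restriction to the subtree above the child `i` of the
root is `p.2 i`. -/
def graft (p : ℝ × (Fin d → Vertex d → ℝ)) : Vertex d → ℝ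
  | [] => p.1
  | i :: y => p.2 i y

theorem measurable_graft : Measurable (graft (d := d)) := by
  refine measurable_pi_iff.2 fun x => ?_
  cases x with
  | nil => exact measurable_fst
  | cons i y => exact (measurable_pi_apply y).comp ((measurable_pi_apply i).comp measurable_snd)

/-- Grafting independent families of weights on an independent root weight gives back the law of
the weights. -/
theorem map_graft :
    ((expMeasure 1).prod (Measure.pi fun _ : Fin d => weightLaw d)).map graft = weightLaw d := by
  classical
  refine Measure.eq_infinitePi _ fun s t ht => ?_
  set t' : Vertex d → Set ℝ := fun x => if x ∈ s then t x else Set.univ with ht'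
  have hmt' : ∀ x, MeasurableSet (t' x) := fun x => by
    by_cases hx : x ∈ s <;> simp [t', hx, ht x]
  have hcons : ∀ i : Fin d, Function.Injective (List.cons i) := fun i => List.cons_injective
  let s' : Fin d → Finset (Vertex d) := fun i => s.preimage (List.cons i) (hcons i).injOn
  have hpre : graft ⁻¹' (Set.pi (s : Set (Vertex d)) t) =
      t' [] ×ˢ Set.pi Set.univ fun i => Set.pi (s' i : Set (Vertex d)) fun y => t' (i :: y) := by
    ext p
    simp only [Set.mem_preimage, Set.mem_pi, Set.mem_prod, Set.mem_univ, forall_true_left]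
    constructor
    · intro h
      refine ⟨?_, fun i y hy => ?_⟩
      · by_cases hn : ([] : Vertex d) ∈ s
        · simpa [t', hn, graft] using h [] hn
        · simp [t', hn]
      · have hy' : (i :: y) ∈ s := by simpa [s'] using hy
        simpa [t', hy', graft] using h _ hy'
    · rintro ⟨h0, h1⟩ x hx
      have hx' : x ∈ s := hx
      cases x with
      | nil => simpa [t', hx', graft] using h0
      | cons i y => simpa [t', hx', graft] using h1 i y (by simpa [s'] using hx')
  rw [Measure.map_apply measurable_graft (.pi s.countable_toSet fun x _ => ht x), hpre,
    Measure.prod_prod, Measure.pi_pi]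
  have h1 : ∀ i, weightLaw d (Set.pi (s' i : Set (Vertex d)) fun y => t' (i :: y)) =
      ∏ y ∈ s' i, expMeasure 1 (t' (i :: y)) := fun i =>
    Measure.infinitePi_pi _ fun y _ => hmt' _
  simp only [h1]
  have h2 : ∏ x ∈ s, expMeasure 1 (t x) = ∏ x ∈ s, expMeasure 1 (t' x) :=
    Finset.prod_congr rfl fun x hx => by simp [t', hx]
  rw [h2, ← Finset.prod_filter_mul_prod_filter_not s (fun x => x = [])]
  congr 1
  · by_cases hn : ([] : Vertex d) ∈ s
    · rw [Finset.filter_eq' s []]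
      simp [hn]
    · rw [Finset.filter_eq' s []]
      simp [hn, t']
  · rw [Finset.prod_sigma']
    refine Finset.prod_bij (fun p _ => p.1 :: p.2) ?_ ?_ ?_ ?_
    · rintro ⟨i, y⟩ h
      simpa [s'] using h
    · rintro ⟨i, y⟩ _ ⟨j, z⟩ _ h
      simp only [List.cons.injEq] at h
      obtain ⟨rfl, rfl⟩ := h
      rfl
    · intro x hx
      cases x with
      | nil => simp at hx
      | cons i y => exact ⟨⟨i, y⟩, by simpa [s'] using hx, rfl⟩
    · intros
      rfl

theorem weightLaw_apply {E : Set (Vertex d → ℝ)} (hE : MeasurableSet E) :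
    weightLaw d E =
      ∫⁻ a, Measure.pi (fun _ : Fin d => weightLaw d) {v | graft (a, v) ∈ E} ∂expMeasure 1 := by
  conv_lhs => rw [← map_graft, Measure.map_apply measurable_graft hE]
  rw [Measure.prod_apply (measurable_graft hE)]
  rfl

/-- Replacing one weight by an independent copy does not change the law of the weights. -/
theorem map_update (z : Vertex d) :
    ((weightLaw d).prod (expMeasure 1)).map
      (fun p : (Vertex d → ℝ) × ℝ => Function.update p.1 z p.2) = weightLaw d := by
  classical
  refine Measure.eq_infinitePi _ fun s t ht => ?_
  have hm : Measurable fun p : (Vertex d → ℝ) × ℝ => Function.update p.1 z p.2 := by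
    refine measurable_pi_iff.2 fun x => ?_
    by_cases hx : x = z
    · subst hx
      simpa using measurable_snd
    · simp only [Function.update_of_ne hx]
      fun_prop
  rw [Measure.map_apply hm (.pi s.countable_toSet fun x _ => ht x)]
  by_cases hz : z ∈ s
  · have hpre : (fun p : (Vertex d → ℝ) × ℝ => Function.update p.1 z p.2) ⁻¹'
        (Set.pi (s : Set (Vertex d)) t) =
        (Set.pi (s.erase z : Finset (Vertex d)) t) ×ˢ t z := by
      ext p
      simp only [Set.mem_preimage, Set.mem_pi, Set.mem_prod, Finset.mem_coe, Finset.mem_erase]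
      constructor
      · intro h
        exact ⟨fun x hx => by simpa [Function.update_of_ne hx.1] using h x hx.2,
          by simpa using h z hz⟩
      · rintro ⟨h1, h2⟩ x hx
        by_cases hxz : x = z
        · subst hxz
          simpa using h2
        · simpa [Function.update_of_ne hxz] using h1 x ⟨hxz, hx⟩
    rw [hpre, Measure.prod_prod, weightLaw, Measure.infinitePi_pi _ fun x _ => ht x,
      Finset.prod_erase_mul _ _ hz]
  · have hpre : (fun p : (Vertex d → ℝ) × ℝ => Function.update p.1 z p.2) ⁻¹'
        (Set.pi (s : Set (Vertex d)) t) = (Set.pi (s : Set (Vertex d)) t) ×ˢ Set.univ := by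
      ext p
      simp only [Set.mem_preimage, Set.mem_pi, Set.mem_prod, Finset.mem_coe, Set.mem_univ,
        and_true]
      refine forall₂_congr fun x hx => ?_
      rw [Function.update_of_ne (fun h : x = z => hz (h ▸ hx))]
    rw [hpre, Measure.prod_prod, weightLaw, Measure.infinitePi_pi _ fun x _ => ht x]
    simp

theorem map_eval_weightLaw (x : Vertex d) : (weightLaw d).map (fun u => u x) = expMeasure 1 :=
  Measure.infinitePi_map_eval _ x

/-! ### Exponential distributions -/

theorem expMeasure_eq (r : ℝ) :
    expMeasure r = (volume : Measure ℝ).withDensity (exponentialPDF r) := rfl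

theorem expMeasure_singleton (r a : ℝ) : expMeasure r {a} = 0 :=
  withDensity_absolutelyContinuous _ _ (measure_singleton a)

theorem measurable_exponentialPDF (r : ℝ) : Measurable (exponentialPDF r) :=
  (measurable_exponentialPDFReal r).ennreal_ofReal

theorem expMeasure_Iic_zero : expMeasure 1 (Set.Iic 0) = 0 := by
  rw [expMeasure_eq, withDensity_apply _ measurableSet_Iic, ← setLIntegral_congr Iio_ae_eq_Iic]
  exact lintegral_exponentialPDF_of_nonpos le_rfl

theorem integral_expMeasure {r : ℝ} (hr : 0 < r) (g : ℝ → ℝ) :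
    ∫ y, g y ∂expMeasure r = ∫ y in Set.Ioi 0, r * Real.exp (-(r * y)) * g y := by
  rw [expMeasure_eq, integral_withDensity_eq_integral_toReal_smul (measurable_exponentialPDF r)
    (by simp [exponentialPDF]), ← integral_Ici_eq_integral_Ioi,
    ← integral_indicator measurableSet_Ici]
  refine integral_congr_ae (Eventually.of_forall fun y => ?_)
  by_cases hy : 0 ≤ y
  · have : 0 ≤ r * Real.exp (-(r * y)) := by positivity
    simp [exponentialPDF_of_nonneg hy, hy, ENNReal.toReal_ofReal this]
  · simp [exponentialPDF_of_neg (not_le.1 hy), hy]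

theorem lintegral_expMeasure_one (g : ℝ → ENNReal) (hg : Measurable g) :
    ∫⁻ y, g y ∂expMeasure 1 = ∫⁻ y in Set.Ioi 0, ENNReal.ofReal (Real.exp (-y)) * g y := by
  rw [expMeasure_eq, lintegral_withDensity_eq_lintegral_mul _ (measurable_exponentialPDF 1) hg,
    setLIntegral_congr (Ioi_ae_eq_Ici (a := (0 : ℝ))), ← lintegral_indicator measurableSet_Ici]
  refine lintegral_congr fun y => ?_
  by_cases hy : 0 ≤ y
  · simp [exponentialPDF_of_nonneg hy, hy]
  · simp [exponentialPDF_of_neg (not_le.1 hy), hy]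

/-! ### Passage times -/

theorem passageTime_nil (α : ℝ) (u : Vertex d → ℝ) : passageTime α u [] = u [] := by
  simp [passageTime]

theorem passageTime_graft_cons (α : ℝ) (a : ℝ) (v : Fin d → Vertex d → ℝ) (i : Fin d)
    (y : Vertex d) :
    passageTime α (graft (a, v)) (i :: y) = a + α * passageTime α (v i) y := by
  unfold passageTime
  rw [List.length_cons, Finset.sum_range_succ' _ (y.length + 1), Finset.mul_sum, add_comm]
  congr 1
  · simp [graft]
  · refine Finset.sum_congr rfl fun j _ => ?_
    simp [graft, pow_succ]
    ring

theorem measurable_passageTime (α : ℝ) (x : Vertex d) :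
    Measurable fun u : Vertex d → ℝ => passageTime α u x := by
  unfold passageTime
  fun_prop

/-- Passage times strictly increase along a path. -/
theorem passageTime_take_lt {α : ℝ} (hα : 0 < α) {u : Vertex d → ℝ} (hu : ∀ x, 0 < u x)
    (x : Vertex d) {n : ℕ} (hn : n < x.length) :
    passageTime α u (x.take n) < passageTime α u x := by
  unfold passageTime
  have hlen : (x.take n).length = n := by simp [hn.le]
  rw [hlen]
  have h1 : ∑ j ∈ Finset.range (n + 1), α ^ j * u ((x.take n).take j) =
      ∑ j ∈ Finset.range (n + 1), α ^ j * u (x.take j) := by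
    refine Finset.sum_congr rfl fun j hj => ?_
    rw [List.take_take, min_eq_left (Nat.lt_succ_iff.1 (Finset.mem_range.1 hj))]
  rw [h1]
  refine Finset.sum_lt_sum_of_subset (i := n + 1) ?_ ?_ ?_ ?_ ?_
  · exact Finset.range_mono (by omega)
  · simpa using hn
  · simp
  · exact mul_pos (pow_pos hα _) (hu _)
  · intro j _ _
    exact (mul_pos (pow_pos hα _) (hu _)).le

theorem passageTime_take_le {α : ℝ} (hα : 0 < α) {u : Vertex d → ℝ} (hu : ∀ x, 0 < u x)
    (x : Vertex d) (n : ℕ) : passageTime α u (x.take n) ≤ passageTime α u x := by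
  rcases lt_or_ge n x.length with h | h
  · exact (passageTime_take_lt hα hu x h).le
  · rw [List.take_of_length_le h]

theorem passageTime_pos {α : ℝ} (hα : 0 < α) {u : Vertex d → ℝ} (hu : ∀ x, 0 < u x)
    (x : Vertex d) : 0 < passageTime α u x :=
  Finset.sum_pos (fun j _ => mul_pos (pow_pos hα _) (hu _)) (by simp)

/-- The event that percolation has not reached infinity by time `t`: some level is completely
dry. -/
def surviving (α t : ℝ) : Set (Vertex d → ℝ) :=
  {u | ∃ n : ℕ, ∀ x : Vertex d, x.length = n → t < passageTime α u x}

/-- The event that level `n` is completely dry at time `t`. -/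
def dryLevel (α t : ℝ) (n : ℕ) : Set (Vertex d → ℝ) :=
  {u | ∀ x : Vertex d, x.length = n → t < passageTime α u x}

theorem surviving_eq_iUnion (α t : ℝ) :
    (surviving α t : Set (Vertex d → ℝ)) = ⋃ n, dryLevel α t n := by
  ext u
  simp [surviving, dryLevel]

theorem measurableSet_dryLevel (α t : ℝ) (n : ℕ) :
    MeasurableSet (dryLevel α t n : Set (Vertex d → ℝ)) := by
  have : (dryLevel α t n : Set (Vertex d → ℝ)) =
      ⋂ x : Vertex d, ⋂ _ : x.length = n, {u | t < passageTime α u x} := by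
    ext u
    simp [dryLevel]
  rw [this]
  exact .iInter fun x => .iInter fun _ =>
    measurableSet_lt measurable_const (measurable_passageTime α x)

theorem measurableSet_surviving (α t : ℝ) :
    MeasurableSet (surviving α t : Set (Vertex d → ℝ)) := by
  rw [surviving_eq_iUnion]
  exact .iUnion fun n => measurableSet_dryLevel α t n

theorem dryLevel_mono {α t : ℝ} (hα : 0 < α) {u : Vertex d → ℝ} (hu : ∀ x, 0 < u x) {m n : ℕ}
    (hmn : m ≤ n) (h : u ∈ dryLevel α t m) : u ∈ dryLevel α t n := fun x hx =>
  (h (x.take m) (by simp [hx, hmn])).trans_le (passageTime_take_le hα hu x m)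

theorem surviving_anti (α : ℝ) {s t : ℝ} (hst : s ≤ t) :
    (surviving α t : Set (Vertex d → ℝ)) ⊆ surviving α s :=
  fun _ ⟨n, hn⟩ => ⟨n, fun x hx => hst.trans_lt (hn x hx)⟩

theorem lt_add_mul_iff {α : ℝ} (hα : 0 < α) (t a p : ℝ) :
    t < a + α * p ↔ (t - a) / α < p := by
  rw [div_lt_iff₀ hα]
  constructor <;> intro h <;> linarith

theorem graft_mem_dryLevel_succ {α : ℝ} (hα : 0 < α) (t a : ℝ) (v : Fin d → Vertex d → ℝ)
    (n : ℕ) :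
    graft (a, v) ∈ dryLevel α t (n + 1) ↔ ∀ i, v i ∈ dryLevel α ((t - a) / α) n := by
  constructor
  · intro h i y hy
    have := h (i :: y) (by simp [hy])
    rwa [passageTime_graft_cons, lt_add_mul_iff hα] at this
  · intro h x hx
    cases x with
    | nil => simp at hx
    | cons i y =>
      rw [passageTime_graft_cons, lt_add_mul_iff hα]
      exact h i y (by simpa using hx)

/-- Percolation survives time `t` exactly if it survives the remaining rescaled time in all the
subtrees above the children of the root. -/
theorem graft_mem_surviving {α : ℝ} (hα : 0 < α) (t a : ℝ) (v : Fin d → Vertex d → ℝ)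
    (hu : ∀ x, 0 < graft (a, v) x) :
    graft (a, v) ∈ surviving α t ↔ ∀ i, v i ∈ surviving α ((t - a) / α) := by
  have hv : ∀ i x, 0 < v i x := fun i x => hu (i :: x)
  constructor
  · rintro ⟨n, hn⟩ i
    have h1 : graft (a, v) ∈ dryLevel α t (n + 1) := dryLevel_mono hα hu (Nat.le_succ n) hn
    exact ⟨n, (graft_mem_dryLevel_succ hα t a v n).1 h1 i⟩
  · intro h
    choose n hn using h
    refine ⟨Finset.univ.sup n + 1, (graft_mem_dryLevel_succ hα t a v _).2 fun i => ?_⟩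
    exact dryLevel_mono hα (hv i) (Finset.le_sup (Finset.mem_univ i)) (hn i)

/-! ### Almost sure properties of the weights -/

theorem ae_weight_pos : ∀ᵐ u ∂weightLaw d, ∀ x, 0 < u x := by
  refine ae_all_iff.2 fun x => ?_
  have h : ∀ᵐ a ∂expMeasure 1, 0 < a := by
    rw [ae_iff]
    convert expMeasure_Iic_zero using 2
    ext a
    simp
  rw [← map_eval_weightLaw x] at h
  exact ae_of_ae_map (measurable_pi_apply x).aemeasurable h

/-- A weight almost surely differs from any given function of the other weights. -/
theorem ae_ne_of_update_eq (z : Vertex d) {g : (Vertex d → ℝ) → ℝ} (hg : Measurable g)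
    (hgz : ∀ u a, g (Function.update u z a) = g u) : ∀ᵐ u ∂weightLaw d, u z ≠ g u := by
  have hE : MeasurableSet {u : Vertex d → ℝ | u z = g u} :=
    measurableSet_eq_fun (measurable_pi_apply z) hg
  have hm : Measurable fun p : (Vertex d → ℝ) × ℝ => Function.update p.1 z p.2 := by
    refine measurable_pi_iff.2 fun x => ?_
    by_cases hx : x = z
    · subst hx
      simpa using measurable_snd
    · simp only [Function.update_of_ne hx]
      fun_prop
  rw [ae_iff]
  simp only [not_not]
  rw [← map_update z, Measure.map_apply hm hE, Measure.prod_apply (hm hE)]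
  refine (lintegral_congr fun u => ?_).trans lintegral_zero
  have : Prod.mk u ⁻¹' ((fun p : (Vertex d → ℝ) × ℝ => Function.update p.1 z p.2) ⁻¹'
      {u | u z = g u}) = {g u} := by
    ext a
    simp [hgz]
  rw [this, expMeasure_singleton]

theorem ae_passageTime_ne {α : ℝ} (hα : 0 < α) {x y : Vertex d} (hxy : x ≠ y)
    (hlen : y.length ≤ x.length) :
    ∀ᵐ u ∂weightLaw d, passageTime α u x ≠ passageTime α u y := by
  have hy : ∀ (u : Vertex d → ℝ) a, passageTime α (Function.update u x a) y =
      passageTime α u y := fun u a => by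
    unfold passageTime
    refine Finset.sum_congr rfl fun j _ => ?_
    rw [Function.update_of_ne]
    intro h
    have h1 : (y.take j).length = x.length := by rw [h]
    rw [List.length_take] at h1
    have h2 : y.length ≤ j := by omega
    rw [List.take_of_length_le h2] at h
    exact hxy h.symm
  have hx : ∀ (u : Vertex d → ℝ) a,
      ∑ j ∈ Finset.range x.length, α ^ j * Function.update u x a (x.take j) =
      ∑ j ∈ Finset.range x.length, α ^ j * u (x.take j) := fun u a => by
    refine Finset.sum_congr rfl fun j hj => ?_
    rw [Function.update_of_ne]
    intro h
    have h1 : (x.take j).length = x.length := by rw [h]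
    rw [List.length_take] at h1
    have := Finset.mem_range.1 hj
    omega
  have hm := measurable_passageTime α y
  have := ae_ne_of_update_eq x (g := fun u => (passageTime α u y -
    ∑ j ∈ Finset.range x.length, α ^ j * u (x.take j)) / α ^ x.length) (by fun_prop)
    (fun u a => by rw [hy, hx])
  filter_upwards [this] with u hu h
  refine hu ?_
  rw [eq_div_iff (pow_pos hα _).ne', ← h]
  unfold passageTime
  rw [Finset.sum_range_succ, List.take_length]
  ring

theorem ae_injective_passageTime {α : ℝ} (hα : 0 < α) :
    ∀ᵐ u ∂weightLaw d, Function.Injective (passageTime α u) := by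
  have : ∀ᵐ u ∂weightLaw d, ∀ x y : Vertex d, x ≠ y → passageTime α u x ≠ passageTime α u y := by
    refine ae_all_iff.2 fun x => ae_all_iff.2 fun y => ?_
    by_cases hxy : x = y
    · simp [hxy]
    rcases le_total y.length x.length with h | h
    · filter_upwards [ae_passageTime_ne hα hxy h] with u hu _ using hu
    · filter_upwards [ae_passageTime_ne hα (Ne.symm hxy) h] with u hu _ using hu.symm
  filter_upwards [this] with u hu x y h
  by_contra hne
  exact hu x y hne h

/-! ### The explosion time -/

/-- The counting function of a finite set of positive numbers takes each value up to the
cardinality. -/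
theorem exists_card_filter_le_eq (B : Finset ℝ) (hB : ∀ b ∈ B, 0 < b) {k : ℕ}
    (hk : k ≤ B.card) : ∃ s ∈ insert 0 B, (B.filter (· ≤ s)).card = k := by
  classical
  induction B using Finset.induction_on_max generalizing k with
  | empty => exact ⟨0, by simp, by simp at hk; simp [hk]⟩
  | insert a B ha ih =>
    have haB : a ∉ B := fun h => lt_irrefl _ (ha a h)
    rw [Finset.card_insert_of_notMem haB] at hk
    rcases Nat.lt_or_ge B.card k with h | h
    · refine ⟨a, by simp, ?_⟩
      rw [Finset.filter_true_of_mem, Finset.card_insert_of_notMem haB]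
      · omega
      · intro b hb
        rcases Finset.mem_insert.1 hb with rfl | hb
        · exact le_rfl
        · exact (ha b hb).le
    · obtain ⟨s, hs, hcard⟩ := ih (fun b hb => hB b (Finset.mem_insert_of_mem hb)) h
      refine ⟨s, ?_, ?_⟩
      · rcases Finset.mem_insert.1 hs with rfl | hs <;> simp [*]
      · rw [Finset.filter_insert, if_neg, hcard]
        rcases Finset.mem_insert.1 hs with rfl | hs
        · exact not_le.2 (hB a (Finset.mem_insert_self _ _))
        · exact not_le.2 (ha s hs)

theorem finite_length_lt (d n : ℕ) : {x : Vertex d | x.length < n}.Finite :=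
  List.finite_length_lt _ n

theorem cluster_finite_of_dryLevel {α : ℝ} (hα : 0 < α) {u : Vertex d → ℝ} (hu : ∀ x, 0 < u x)
    {t : ℝ} {n : ℕ} (h : u ∈ dryLevel α t n) : (cluster α u (t : EReal)).Finite := by
  refine (finite_length_lt d n).subset fun x hx => ?_
  by_contra hlen
  have h1 : passageTime α u x ≤ t := by simpa [cluster] using hx
  have h2 := h (x.take n) (by simpa using hlen)
  exact absurd (h2.trans_le (passageTime_take_le hα hu x n)) (not_lt.2 h1)

/-- For positive weights with distinct passage times, the explosion time exceeds `t` exactly if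
some level is dry at time `t`. -/
theorem lt_explosionTime_iff {α : ℝ} (hα : 0 < α) {u : Vertex d → ℝ} (hu : ∀ x, 0 < u x)
    (hinj : Function.Injective (passageTime α u)) (hd : 0 < d) (t : ℝ) :
    (t : EReal) < explosionTime α u ↔ u ∈ surviving α t := by
  classical
  have hlev : ∀ n : ℕ, ∃ x : Vertex d, x.length = n ∧
      ∀ y : Vertex d, y.length = n → passageTime α u x ≤ passageTime α u y := fun n => by
    have hfin : {x : Vertex d | x.length = n}.Finite :=
      (finite_length_lt d (n + 1)).subset fun x hx => by
        have : x.length = n := hx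
        simp [this]
    obtain ⟨x, hx, hmin⟩ := hfin.exists_minimalFor (passageTime α u) _
      ⟨List.replicate n ⟨0, hd⟩, by simp⟩
    exact ⟨x, hx, fun y hy => (le_total _ _).elim id fun h => hmin hy h⟩
  constructor
  · contrapose!
    intro hS
    refine iSup_le fun k => ?_
    have hS' : ∀ n : ℕ, ∃ x : Vertex d, x.length = n ∧ passageTime α u x ≤ t := by
      simpa [surviving] using hS
    obtain ⟨x, hxk, hx⟩ := hlev k
    obtain ⟨z, hzk, hz⟩ := hlev (k + 1)
    -- at the first time at which level `k` is reached, level `k + 1` is still dry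
    have hdry : u ∈ dryLevel α (passageTime α u x) (k + 1) := fun y hy =>
      (hx (y.take k) (by simp [hy])).trans_lt (passageTime_take_lt hα hu y (by omega))
    have hfin := cluster_finite_of_dryLevel hα hu hdry
    set A := hfin.toFinset with hA
    have hmemA : ∀ y, y ∈ A ↔ passageTime α u y ≤ passageTime α u x := fun y => by
      simp [hA, cluster]
    have hcard : k ≤ (A.image (passageTime α u)).card := by
      rw [Finset.card_image_of_injective _ hinj]
      have hsub : (Finset.range (k + 1)).image (fun j => x.take j) ⊆ A := by
        intro y hy
        obtain ⟨j, _, rfl⟩ := Finset.mem_image.1 hy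
        exact (hmemA _).2 (passageTime_take_le hα hu x j)
      refine le_trans ?_ (Finset.card_le_card hsub)
      rw [Finset.card_image_of_injOn, Finset.card_range]
      · omega
      · intro i hi j hj hij
        have h1 := congrArg List.length hij
        simp only [List.length_take, Finset.coe_range, Set.mem_Iio] at h1 hi hj
        omega
    obtain ⟨s, hs, hsk⟩ := exists_card_filter_le_eq _ (fun b hb => by
      obtain ⟨y, _, rfl⟩ := Finset.mem_image.1 hb
      exact passageTime_pos hα hu y) hcard
    have hs0 : 0 ≤ s ∧ s ≤ passageTime α u x := by
      rcases Finset.mem_insert.1 hs with rfl | hs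
      · exact ⟨le_rfl, (passageTime_pos hα hu x).le⟩
      · obtain ⟨y, hy, rfl⟩ := Finset.mem_image.1 hs
        exact ⟨(passageTime_pos hα hu y).le, (hmemA y).1 hy⟩
    have hcl : cluster α u (s : EReal) = (A.filter fun y => passageTime α u y ≤ s : Finset _) := by
      ext y
      simp only [cluster, Set.mem_ofPred_eq, EReal.coe_le_coe_iff, Finset.coe_filter, hmemA]
      exact ⟨fun h => ⟨h.trans hs0.2, h⟩, fun h => h.2⟩
    have hk : (cluster α u (s : EReal)).encard = (k : ℕ∞) := by
      rw [hcl, Set.encard_coe_eq_coe_finsetCard, ← hsk, Finset.filter_image,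
        Finset.card_image_of_injective _ hinj]
    obtain ⟨y, hyk, hy⟩ := hS' k
    calc fillTime α u k ≤ (s : EReal) := sInf_le ⟨by exact_mod_cast hs0.1, hk⟩
      _ ≤ (t : EReal) := by exact_mod_cast hs0.2.trans ((hx y hyk).trans hy)
  · rintro ⟨n, hn⟩
    obtain ⟨x, hxn, hx⟩ := hlev n
    -- the cluster does not change between `t` and a slightly later time `t'`
    obtain ⟨t', htt', ht'⟩ := exists_between (hn x hxn)
    have hdry : u ∈ dryLevel α t' n := fun y hy => ht'.trans_le (hx y hy)
    have hfin := cluster_finite_of_dryLevel hα hu hdry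
    obtain ⟨m, hm⟩ := hfin.exists_encard_eq_coe
    have : (t' : EReal) ≤ fillTime α u (m + 1) := by
      refine le_sInf fun s hs => ?_
      by_contra hlt
      have hsub : cluster α u s ⊆ cluster α u (t' : EReal) := fun y hy =>
        le_trans (show (passageTime α u y : EReal) ≤ s from hy) (not_le.1 hlt).le
      have := Set.encard_le_encard hsub
      rw [hs.2, hm] at this
      have h2 : m + 1 ≤ m := by exact_mod_cast this
      omega
    calc (t : EReal) < (t' : EReal) := by exact_mod_cast htt'
      _ ≤ fillTime α u (m + 1) := this
      _ ≤ explosionTime α u := le_iSup (fillTime α u) (m + 1)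

/-! ### The survival function -/

/-- The probability `P(T(∞) > t)` that percolation has not reached infinity by time `t`. -/
def survival (α : ℝ) (d : ℕ) (t : ℝ) : ℝ := (weightLaw d).real (surviving α t)

/-- The probability that the vertex `x` gets wet within the window `t + W` and percolation
survives time `t`. -/
def hitProb (α : ℝ) (W : Set ℝ) (x : Vertex d) (t : ℝ) : ENNReal :=
  weightLaw d {u | passageTime α u x - t ∈ W ∧ u ∈ surviving α t}

theorem ofReal_survival (α : ℝ) (d : ℕ) (t : ℝ) :
    ENNReal.ofReal (survival α d t) = weightLaw d (surviving α t) :=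
  ofReal_measureReal

theorem survival_nonneg (α : ℝ) (d : ℕ) (t : ℝ) : 0 ≤ survival α d t := measureReal_nonneg

theorem survival_le_one (α : ℝ) (d : ℕ) (t : ℝ) : survival α d t ≤ 1 := measureReal_le_one

theorem survival_antitone (α : ℝ) (d : ℕ) : Antitone (survival α d) := fun _ _ h =>
  measureReal_mono (surviving_anti α h)

theorem measurable_survival (α : ℝ) (d : ℕ) : Measurable (survival α d) :=
  (survival_antitone α d).measurable

theorem survival_of_nonpos (α : ℝ) {t : ℝ} (ht : t ≤ 0) : survival α d t = 1 := by
  have : ∀ᵐ u ∂weightLaw d, u ∈ surviving α t := by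
    filter_upwards [ae_weight_pos] with u hu
    refine ⟨0, fun x hx => ?_⟩
    rw [List.length_eq_zero_iff.1 hx, passageTime_nil]
    exact ht.trans_lt (hu _)
  rw [survival, measureReal_def,
    (prob_compl_eq_zero_iff (measurableSet_surviving α t)).1 this, ENNReal.toReal_one]

theorem ae_ae_graft_pos :
    ∀ᵐ a ∂expMeasure 1, ∀ᵐ v ∂Measure.pi (fun _ : Fin d => weightLaw d),
      ∀ x, 0 < graft (a, v) x := by
  have h := ae_weight_pos (d := d)
  rw [← map_graft] at h
  exact Measure.ae_ae_of_ae_prod (ae_of_ae_map measurable_graft.aemeasurable h)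

theorem measure_surviving_eq {α : ℝ} (hα : 0 < α) (t : ℝ) :
    weightLaw d (surviving α t) =
      ∫⁻ a, weightLaw d (surviving α ((t - a) / α)) ^ d ∂expMeasure 1 := by
  rw [weightLaw_apply (measurableSet_surviving α t)]
  refine lintegral_congr_ae ?_
  filter_upwards [ae_ae_graft_pos (d := d)] with a ha
  have : {v | graft (a, v) ∈ surviving α t} =ᵐ[Measure.pi fun _ : Fin d => weightLaw d]
      Set.pi Set.univ fun _ : Fin d => surviving α ((t - a) / α) := by
    refine eventuallyEq_set.2 ?_
    filter_upwards [ha] with v hv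
    simpa [Set.mem_pi] using graft_mem_surviving hα t a v hv
  rw [measure_congr this, Measure.pi_pi]
  simp

/-- The renewal equation for the survival function. -/
theorem survival_eq {α : ℝ} (hα : 0 < α) (t : ℝ) :
    survival α d t = ∫ a, survival α d ((t - a) / α) ^ d ∂expMeasure 1 := by
  rw [integral_eq_lintegral_of_nonneg_ae
    (Eventually.of_forall fun a => pow_nonneg (survival_nonneg _ _ _) _)
    (((measurable_survival α d).comp (by fun_prop)).pow_const d).aestronglyMeasurable,
    survival, measureReal_def, measure_surviving_eq hα]
  congr 1
  refine lintegral_congr fun a => ?_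
  rw [ENNReal.ofReal_pow (survival_nonneg _ _ _), ofReal_survival]

/-- The renewal equation for the hitting probabilities: one of the subtrees above the children of
the root contains the vertex, and percolation has to survive in the other `d - 1` as well. -/
theorem hitProb_cons {α : ℝ} (hα : 0 < α) {W : Set ℝ} (hW : MeasurableSet W) (i : Fin d)
    (y : Vertex d) (t : ℝ) :
    hitProb α W (i :: y) t =
      ∫⁻ a, hitProb α ((fun w => α * w) ⁻¹' W) y ((t - a) / α) *
        weightLaw d (surviving α ((t - a) / α)) ^ (d - 1) ∂expMeasure 1 := by
  classical
  have hE : MeasurableSet {u : Vertex d → ℝ | passageTime α u (i :: y) - t ∈ W ∧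
      u ∈ surviving α t} :=
    (((measurable_passageTime α (i :: y)).sub_const t) hW).inter (measurableSet_surviving α t)
  rw [hitProb, weightLaw_apply hE]
  refine lintegral_congr_ae ?_
  filter_upwards [ae_ae_graft_pos (d := d)] with a ha
  set r := (t - a) / α with hr
  have hE' : {v | graft (a, v) ∈ {u : Vertex d → ℝ | passageTime α u (i :: y) - t ∈ W ∧
      u ∈ surviving α t}} =ᵐ[Measure.pi fun _ : Fin d => weightLaw d]
      Set.pi Set.univ (Function.update (fun _ : Fin d => surviving α r) i
        {u | passageTime α u y - r ∈ (fun w => α * w) ⁻¹' W ∧ u ∈ surviving α r}) := by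
    refine eventuallyEq_set.2 ?_
    filter_upwards [ha] with v hv
    have h1 : passageTime α (graft (a, v)) (i :: y) - t = α * (passageTime α (v i) y - r) := by
      rw [passageTime_graft_cons, hr]
      field_simp
      ring
    change (passageTime α (graft (a, v)) (i :: y) - t ∈ W ∧ graft (a, v) ∈ surviving α t) ↔ _
    rw [h1, graft_mem_surviving hα t a v hv]
    simp only [Set.mem_pi, Set.mem_univ, forall_true_left]
    constructor
    · rintro ⟨h2, h3⟩ j
      by_cases hj : j = i
      · subst hj
        simpa using ⟨h2, h3 j⟩
      · simpa [Function.update_of_ne hj] using h3 j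
    · intro h
      have hi := h i
      rw [Function.update_self] at hi
      refine ⟨hi.1, fun j => ?_⟩
      by_cases hj : j = i
      · subst hj
        exact hi.2
      · simpa [Function.update_of_ne hj] using h j
  refine (measure_congr hE').trans ?_
  rw [Measure.pi_pi, ← Finset.mul_prod_erase _ _ (Finset.mem_univ i),
    Function.update_self]
  congr 1
  rw [Finset.prod_congr rfl fun j hj => by
    rw [Function.update_of_ne (Finset.ne_of_mem_erase hj)], Finset.prod_const]
  simp

/-! ### Exponential decay of the survival function -/

theorem lintegral_exp_mul_expMeasure {θ : ℝ} (hθ : θ < 1) :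
    ∫⁻ a, ENNReal.ofReal (Real.exp (θ * a)) ∂expMeasure 1 = ENNReal.ofReal (1 - θ)⁻¹ := by
  rw [lintegral_expMeasure_one _ (by fun_prop)]
  have h1 : ∀ a : ℝ, ENNReal.ofReal (Real.exp (-a)) * ENNReal.ofReal (Real.exp (θ * a)) =
      ENNReal.ofReal (Real.exp (-(1 - θ) * a)) := fun a => by
    rw [← ENNReal.ofReal_mul (Real.exp_pos _).le, ← Real.exp_add]
    congr 2
    ring
  simp only [h1]
  have hneg : -(1 - θ) < 0 := by linarith
  rw [← ofReal_integral_eq_lintegral_ofReal (integrableOn_exp_mul_Ioi hneg 0)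
    (Eventually.of_forall fun a => (Real.exp_pos _).le), integral_exp_mul_Ioi hneg 0]
  congr 1
  rw [mul_zero, Real.exp_zero, neg_div_neg_eq, one_div]

theorem inv_one_sub_le_exp {θ : ℝ} (h0 : 0 ≤ θ) (h1 : θ ≤ 3 / 4) :
    (1 - θ)⁻¹ ≤ Real.exp (4 * θ) := by
  have h2 := Real.add_one_le_exp (4 * θ)
  refine le_trans ?_ h2
  rw [inv_le_comm₀ (by linarith) (by linarith), inv_le_iff_one_le_mul₀ (by linarith)]
  nlinarith

/-- A Chernoff bound along the recursion, in which all but one of the `d` subtrees are ignored. -/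
theorem measure_dryLevel_le {α : ℝ} (h0 : 0 < α) (h1 : α < 1) (hd : d ≠ 0) (n : ℕ) (t : ℝ)
    {θ : ℝ} (hθ0 : 0 ≤ θ) (hθ1 : θ ≤ 3 / 4) :
    weightLaw d (dryLevel α t n) ≤
      ENNReal.ofReal (Real.exp (4 / (1 - α) * θ - θ * t)) := by
  have h1α : 0 < 1 - α := by linarith
  induction n generalizing t θ with
  | zero =>
    have hle : (dryLevel α t 0 : Set (Vertex d → ℝ)) ⊆ (fun u => u []) ⁻¹' Set.Ioi t := by
      intro u hu
      simpa [passageTime_nil] using hu [] rfl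
    calc weightLaw d (dryLevel α t 0) ≤ expMeasure 1 (Set.Ioi t) := by
          refine (measure_mono hle).trans_eq ?_
          rw [← map_eval_weightLaw (d := d) [], Measure.map_apply (measurable_pi_apply _)
            measurableSet_Ioi]
      _ ≤ ∫⁻ a, ENNReal.ofReal (Real.exp (-(θ * t))) * ENNReal.ofReal (Real.exp (θ * a))
            ∂expMeasure 1 := by
          rw [← lintegral_indicator_one measurableSet_Ioi]
          refine lintegral_mono fun a => ?_
          rw [← ENNReal.ofReal_mul (Real.exp_pos _).le, ← Real.exp_add]
          by_cases ha : t < a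
          · simp only [Set.indicator_of_mem (Set.mem_Ioi.2 ha), Pi.one_apply,
              ENNReal.one_le_ofReal]
            exact Real.one_le_exp (by nlinarith)
          · simp [ha]
      _ = ENNReal.ofReal (Real.exp (-(θ * t)) * (1 - θ)⁻¹) := by
          rw [lintegral_const_mul _ (by fun_prop), lintegral_exp_mul_expMeasure (by linarith),
            ENNReal.ofReal_mul (Real.exp_pos _).le]
      _ ≤ _ := by
          refine ENNReal.ofReal_le_ofReal ?_
          have h2 := inv_one_sub_le_exp hθ0 hθ1
          rw [sub_eq_add_neg (_ * θ), Real.exp_add, mul_comm]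
          refine mul_le_mul_of_nonneg_right (h2.trans (Real.exp_le_exp.2 ?_)) (Real.exp_pos _).le
          refine mul_le_mul_of_nonneg_right ?_ hθ0
          rw [le_div_iff₀ h1α]
          linarith
  | succ n ih =>
    have hθα : α * θ ≤ 3 / 4 := by nlinarith
    calc weightLaw d (dryLevel α t (n + 1))
        = ∫⁻ a, weightLaw d (dryLevel α ((t - a) / α) n) ^ d ∂expMeasure 1 := by
          rw [weightLaw_apply (measurableSet_dryLevel α t _)]
          refine lintegral_congr fun a => ?_
          have : {v | graft (a, v) ∈ dryLevel α t (n + 1)} =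
              Set.pi Set.univ fun _ : Fin d => dryLevel α ((t - a) / α) n := by
            ext v
            simpa [Set.mem_pi] using graft_mem_dryLevel_succ h0 t a v n
          rw [this, Measure.pi_pi]
          simp
      _ ≤ ∫⁻ a, ENNReal.ofReal (Real.exp (4 / (1 - α) * (α * θ) - θ * t)) *
            ENNReal.ofReal (Real.exp (θ * a)) ∂expMeasure 1 := by
          refine lintegral_mono fun a => ?_
          refine (pow_le_of_le_one zero_le prob_le_one hd).trans ?_
          refine (ih ((t - a) / α) (by positivity) hθα).trans_eq ?_
          rw [← ENNReal.ofReal_mul (Real.exp_pos _).le, ← Real.exp_add]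
          congr 2
          field_simp
          ring
      _ = ENNReal.ofReal (Real.exp (4 / (1 - α) * (α * θ) - θ * t) * (1 - θ)⁻¹) := by
          rw [lintegral_const_mul _ (by fun_prop), lintegral_exp_mul_expMeasure (by linarith),
            ENNReal.ofReal_mul (Real.exp_pos _).le]
      _ ≤ _ := by
          refine ENNReal.ofReal_le_ofReal ?_
          refine (mul_le_mul_of_nonneg_left (inv_one_sub_le_exp hθ0 hθ1)
            (Real.exp_pos _).le).trans_eq ?_
          rw [← Real.exp_add]
          congr 1
          field_simp
          ring

theorem survival_le_exp {α : ℝ} (h0 : 0 < α) (h1 : α < 1) (hd : d ≠ 0) (t : ℝ) :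
    survival α d t ≤ Real.exp (3 / (1 - α)) * Real.exp (-(3 / 4 * t)) := by
  have hpos := ae_weight_pos (d := d)
  have h2 : weightLaw d (surviving α t) =
      weightLaw d (⋃ n, dryLevel α t n ∩ {u | ∀ x, 0 < u x}) := by
    rw [← Set.iUnion_inter, ← surviving_eq_iUnion]
    refine measure_congr ?_
    filter_upwards [hpos] with u hu
    exact propext ⟨fun h => ⟨h, hu⟩, fun h => h.1⟩
  have hmono : Monotone fun n => (dryLevel α t n ∩ {u | ∀ x, 0 < u x} : Set (Vertex d → ℝ)) :=
    fun m n hmn u hu => ⟨dryLevel_mono h0 hu.2 hmn hu.1, hu.2⟩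
  refine ENNReal.toReal_le_of_le_ofReal (by positivity) ?_
  rw [h2, hmono.measure_iUnion]
  refine iSup_le fun n => (measure_mono Set.inter_subset_left).trans
    ((measure_dryLevel_le h0 h1 hd n t (θ := 3 / 4) (by norm_num) le_rfl).trans_eq ?_)
  rw [← Real.exp_add]
  congr 2
  ring

/-! ### Regularity and the exact decay rate of the survival function -/

theorem exp_mul_survival {α : ℝ} (hα : 0 < α) (t : ℝ) :
    Real.exp t * survival α d t =
      ∫ s in Set.Iic t, Real.exp s * survival α d (s / α) ^ d := by
  rw [survival_eq hα, integral_expMeasure one_pos, integral_Iic_eq_integral_Iio,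
    ← integral_indicator measurableSet_Iio, ← integral_const_mul,
    ← integral_indicator measurableSet_Ioi,
    ← integral_sub_left_eq_self _ (volume : Measure ℝ) t]
  refine integral_congr_ae (Eventually.of_forall fun a => ?_)
  by_cases ha : a < t
  · have h1 : 0 < t - a := by linarith
    simp only [Set.indicator_of_mem (Set.mem_Ioi.2 h1), Set.indicator_of_mem (Set.mem_Iio.2 ha)]
    rw [one_mul, one_mul, ← mul_assoc, ← Real.exp_add]
    congr 3 <;> ring
  · simp [ha]

theorem integrableOn_exp_mul_survival (α : ℝ) (t : ℝ) :
    IntegrableOn (fun s => Real.exp s * survival α d (s / α) ^ d) (Set.Iic t) := by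
  refine (integrableOn_exp_Iic t).mono' ?_ (Eventually.of_forall fun s => ?_)
  · exact (Real.measurable_exp.mul
      (((measurable_survival α d).comp (by fun_prop)).pow_const d)).aestronglyMeasurable
  · rw [Real.norm_of_nonneg (mul_nonneg (Real.exp_pos _).le
      (pow_nonneg (survival_nonneg _ _ _) _))]
    exact mul_le_of_le_one_right (Real.exp_pos _).le
      (pow_le_one₀ (survival_nonneg _ _ _) (survival_le_one _ _ _))

theorem exp_mul_survival_eq_add {α : ℝ} (hα : 0 < α) (t : ℝ) :
    Real.exp t * survival α d t =
      1 + ∫ s in (0 : ℝ)..t, Real.exp s * survival α d (s / α) ^ d := by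
  have h0 := exp_mul_survival (d := d) hα 0
  rw [survival_of_nonpos α le_rfl, Real.exp_zero, mul_one] at h0
  rw [exp_mul_survival hα t, ← intervalIntegral.integral_Iic_sub_Iic
    (integrableOn_exp_mul_survival α 0) (integrableOn_exp_mul_survival α t), ← h0]
  ring

theorem continuous_survival {α : ℝ} (hα : 0 < α) : Continuous (survival α d) := by
  have h1 : survival α d = fun t => Real.exp (-t) *
      (1 + ∫ s in (0 : ℝ)..t, Real.exp s * survival α d (s / α) ^ d) := by
    ext t
    rw [← exp_mul_survival_eq_add hα, ← mul_assoc, ← Real.exp_add]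
    simp
  rw [h1]
  refine (by fun_prop : Continuous fun t : ℝ => Real.exp (-t)).mul (continuous_const.add ?_)
  refine intervalIntegral.continuous_primitive (fun a b => ?_) 0
  rw [intervalIntegrable_iff]
  exact (integrableOn_exp_mul_survival α (max a b)).mono_set Set.Ioc_subset_Iic_self

theorem hasDerivAt_exp_mul_survival {α : ℝ} (hα : 0 < α) (t : ℝ) :
    HasDerivAt (fun t => Real.exp t * survival α d t)
      (Real.exp t * survival α d (t / α) ^ d) t := by
  have hc := continuous_survival (d := d) hα
  have h2 : Continuous fun s => Real.exp s * survival α d (s / α) ^ d := by fun_prop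
  have h1 : (fun t => Real.exp t * survival α d t) = fun t =>
      1 + ∫ s in (0 : ℝ)..t, Real.exp s * survival α d (s / α) ^ d :=
    funext fun t => exp_mul_survival_eq_add hα t
  rw [h1]
  exact (h2.integral_hasStrictDerivAt 0 t).hasDerivAt.const_add 1

/-- The survival function `F` solves `F'(t) = F(t / α) ^ d - F(t)`. -/
theorem hasDerivAt_survival {α : ℝ} (hα : 0 < α) (t : ℝ) :
    HasDerivAt (survival α d) (survival α d (t / α) ^ d - survival α d t) t := by
  have h1 : survival α d = fun t => Real.exp (-t) * (Real.exp t * survival α d t) := by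
    ext t
    rw [← mul_assoc, ← Real.exp_add]
    simp
  have h2 := (hasDerivAt_neg t).exp.mul (hasDerivAt_exp_mul_survival (d := d) hα t)
  rw [h1]
  refine h2.congr_deriv ?_
  have h3 : Real.exp (-t) * Real.exp t = 1 := by rw [← Real.exp_add]; simp
  simp only
  have h4 : ∀ s, Real.exp (-s) * (Real.exp s * survival α d s) = survival α d s := fun s =>
    (congrFun h1 s).symm
  rw [h4, h4]
  linear_combination (survival α d (t / α) ^ d - survival α d t) * h3

theorem monotone_exp_mul_survival {α : ℝ} (hα : 0 < α) :
    Monotone fun t => Real.exp t * survival α d t :=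
  monotone_of_hasDerivAt_nonneg (fun t => hasDerivAt_exp_mul_survival hα t)
    fun _ => mul_nonneg (Real.exp_pos _).le (pow_nonneg (survival_nonneg _ _ _) _)

/-- The hazard rate of the explosion time is at most one. -/
theorem exp_neg_mul_survival_le {α : ℝ} (hα : 0 < α) (t : ℝ) {y : ℝ} (hy : 0 ≤ y) :
    Real.exp (-y) * survival α d t ≤ survival α d (t + y) := by
  have h := monotone_exp_mul_survival (d := d) hα (le_add_of_nonneg_right hy : t ≤ t + y)
  simp only at h
  have h1 : Real.exp (-(t + y)) * (Real.exp t * survival α d t) ≤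
      Real.exp (-(t + y)) * (Real.exp (t + y) * survival α d (t + y)) :=
    mul_le_mul_of_nonneg_left h (Real.exp_pos _).le
  rw [← mul_assoc, ← mul_assoc, ← Real.exp_add, ← Real.exp_add] at h1
  simpa using h1

theorem survival_pos {α : ℝ} (hα : 0 < α) (t : ℝ) : 0 < survival α d t := by
  rcases le_total t 0 with h | h
  · rw [survival_of_nonpos α h]
    exact one_pos
  · have := exp_neg_mul_survival_le (d := d) hα 0 h
    rw [survival_of_nonpos α le_rfl, zero_add] at this
    exact lt_of_lt_of_le (by positivity) this

theorem survival_pow_le {α : ℝ} (hα : 0 < α) (t : ℝ) :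
    survival α d (t / α) ^ d ≤ survival α d t := by
  have h := (hasDerivAt_survival (d := d) hα t).deriv
  have h2 : deriv (survival α d) t ≤ 0 := (survival_antitone α d).deriv_nonpos
  linarith

/-- The exponent `3 / 4` in `survival_le_exp` bootstraps to the exponent one, since
`exp t * F(t / α) ^ d` is integrable as soon as `F` decays faster than `exp (-t / 2)`. -/
theorem exp_mul_survival_bddAbove {α : ℝ} (h0 : 0 < α) (h1 : α < 1) (hd : 2 ≤ d) :
    BddAbove (Set.range fun t => Real.exp t * survival α d t) := by
  set B := Real.exp (3 / (1 - α)) with hB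
  -- the correction term absorbs the bound on the derivative of `exp t * F t`
  set H : ℝ → ℝ := fun t => Real.exp t * survival α d t + 2 * B ^ d * Real.exp (-(1 / 2) * t)
    with hH
  have hder : ∀ t, HasDerivAt H (Real.exp t * survival α d (t / α) ^ d -
      B ^ d * Real.exp (-(1 / 2) * t)) t := fun t => by
    have h2 := (hasDerivAt_exp_mul_survival (d := d) h0 t).add
      ((((hasDerivAt_id t).const_mul (-(1 / 2) : ℝ)).exp).const_mul (2 * B ^ d))
    refine h2.congr_deriv ?_
    simp only [id_eq]
    ring
  have hanti : AntitoneOn H (Set.Ici 0) := by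
    refine antitoneOn_of_deriv_nonpos (convex_Ici 0)
      (fun t _ => (hder t).continuousAt.continuousWithinAt)
      (fun t _ => (hder t).differentiableAt.differentiableWithinAt) fun t ht => ?_
    rw [(hder t).deriv, sub_nonpos]
    rw [interior_Ici, Set.mem_Ioi] at ht
    have h2 := survival_le_exp (d := d) h0 h1 (by omega) (t / α)
    calc Real.exp t * survival α d (t / α) ^ d
        ≤ Real.exp t * (B * Real.exp (-(3 / 4 * (t / α)))) ^ d := by
          gcongr
          exact survival_nonneg _ _ _
      _ = B ^ d * (Real.exp t * Real.exp (-(3 / 4 * (t / α))) ^ d) := by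
          rw [mul_pow]
          ring
      _ ≤ _ := by
          refine mul_le_mul_of_nonneg_left ?_ (by positivity)
          rw [← Real.exp_nat_mul, ← Real.exp_add, Real.exp_le_exp]
          have h3 : t ≤ t / α := by
            rw [le_div_iff₀ h0]
            nlinarith
          have h4 : (2 : ℝ) ≤ d := by exact_mod_cast hd
          nlinarith
  refine ⟨H 0, ?_⟩
  rintro _ ⟨t, rfl⟩
  have h3 : ∀ t : ℝ, Real.exp t * survival α d t ≤ H t := fun t => by
    have : 0 ≤ 2 * B ^ d * Real.exp (-(1 / 2) * t) := by positivity
    simp only [hH]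
    linarith
  have h4 := (h3 _).trans (hanti Set.self_mem_Ici (Set.mem_Ici.2 (le_max_right t 0))
    (le_max_right t 0))
  exact (monotone_exp_mul_survival h0 (le_max_left t 0)).trans h4

theorem ae_lt_explosionTime_iff {α : ℝ} (hα : 0 < α) (hd : 0 < d) :
    ∀ᵐ u ∂weightLaw d, ∀ t : ℝ, (t : EReal) < explosionTime α u ↔ u ∈ surviving α t := by
  filter_upwards [ae_weight_pos, ae_injective_passageTime hα] with u h1 h2 t
  exact lt_explosionTime_iff hα h1 h2 hd t

theorem tendsto_tailConst {α : ℝ} (h0 : 0 < α) (h1 : α < 1) (hd : 2 ≤ d) :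
    Tendsto (fun t => Real.exp t * survival α d t) atTop (𝓝 (tailConst α d)) := by
  have h2 := tendsto_atTop_ciSup (monotone_exp_mul_survival (d := d) h0)
    (exp_mul_survival_bddAbove h0 h1 hd)
  have h3 : (fun t : ℝ => Real.exp t *
      (weightLaw d).real {u | (t : EReal) < explosionTime α u}) =
      fun t => Real.exp t * survival α d t := by
    ext t
    rw [survival]
    congr 1
    refine measureReal_congr (eventuallyEq_set.2 ?_)
    filter_upwards [ae_lt_explosionTime_iff (d := d) h0 (by omega)] with u hu using hu t
  rw [tailConst, h3, h2.limUnder_eq]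
  exact h2

theorem exp_mul_survival_le_tailConst {α : ℝ} (h0 : 0 < α) (h1 : α < 1) (hd : 2 ≤ d) (t : ℝ) :
    Real.exp t * survival α d t ≤ tailConst α d :=
  (monotone_exp_mul_survival h0).ge_of_tendsto (tendsto_tailConst h0 h1 hd) t

theorem survival_le_tailConst_mul {α : ℝ} (h0 : 0 < α) (h1 : α < 1) (hd : 2 ≤ d) (t : ℝ) :
    survival α d t ≤ tailConst α d * Real.exp (-t) := by
  have h := mul_le_mul_of_nonneg_right (exp_mul_survival_le_tailConst h0 h1 hd t)
    (Real.exp_pos (-t)).le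
  rwa [mul_right_comm, ← Real.exp_add, add_neg_cancel, Real.exp_zero, one_mul] at h

theorem one_le_tailConst {α : ℝ} (h0 : 0 < α) (h1 : α < 1) (hd : 2 ≤ d) :
    1 ≤ tailConst α d := by
  have := exp_mul_survival_le_tailConst h0 h1 hd 0
  rwa [survival_of_nonpos α le_rfl, Real.exp_zero, mul_one] at this

/-! ### Integration against exponential distributions -/

theorem integrable_of_bound_one {X : Type*} [MeasurableSpace X] {ν : Measure X}
    [IsFiniteMeasure ν] {g : X → ℝ} (hg : Measurable g) (h0 : ∀ y, 0 ≤ g y) (h1 : ∀ y, g y ≤ 1) :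
    Integrable g ν :=
  .of_bound hg.aestronglyMeasurable 1
    (Eventually.of_forall fun y => by rw [Real.norm_of_nonneg (h0 y)]; exact h1 y)

theorem integrableOn_exp_neg_mul {θ : ℝ} (hθ : 0 < θ) {g : ℝ → ℝ} (hg : Continuous g) {C : ℝ}
    (hC : ∀ y, |g y| ≤ C) : IntegrableOn (fun y => Real.exp (-(θ * y)) * g y) (Set.Ioi 0) := by
  have h1 : IntegrableOn (fun y => Real.exp (-θ * y) * C) (Set.Ioi 0) :=
    (integrableOn_exp_mul_Ioi (by linarith) 0).mul_const C
  refine h1.mono' (by fun_prop) (Eventually.of_forall fun y => ?_)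
  rw [norm_mul, Real.norm_of_nonneg (Real.exp_pos _).le, neg_mul]
  exact mul_le_mul_of_nonneg_left (hC y) (Real.exp_pos _).le

/-- Integration by parts against an exponential density. -/
theorem integral_expMeasure_eq_add {θ : ℝ} (hθ : 0 < θ) {g g' : ℝ → ℝ}
    (hg : ∀ y, HasDerivAt g (g' y) y) (hg' : Continuous g') {C C' : ℝ} (hC : ∀ y, |g y| ≤ C)
    (hC' : ∀ y, |g' y| ≤ C') :
    ∫ y, g y ∂expMeasure θ = g 0 + θ⁻¹ * ∫ y, g' y ∂expMeasure θ := by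
  have hgc : Continuous g := continuous_iff_continuousAt.2 fun y => (hg y).continuousAt
  have hI := integrableOn_exp_neg_mul hθ hgc hC
  have hI' := integrableOn_exp_neg_mul hθ hg' hC'
  have hexp : ∀ y, HasDerivAt (fun y => Real.exp (-(θ * y))) (-θ * Real.exp (-(θ * y))) y :=
    fun y => by
      have := ((hasDerivAt_id y).const_mul θ).neg.exp
      refine this.congr_deriv ?_
      simp
      ring
  have hder : ∀ y ∈ Set.Ici (0 : ℝ), HasDerivAt (fun y => Real.exp (-(θ * y)) * g y)
      (-θ * (Real.exp (-(θ * y)) * g y) + Real.exp (-(θ * y)) * g' y) y := fun y _ =>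
    ((hexp y).mul (hg y)).congr_deriv (by ring)
  have hlim : Tendsto (fun y => Real.exp (-(θ * y)) * g y) atTop (𝓝 0) := by
    have h1 : Tendsto (fun y => Real.exp (-(θ * y)) * C) atTop (𝓝 0) := by
      have h2 : Tendsto (fun y : ℝ => -(θ * y)) atTop atBot :=
        tendsto_neg_atBot_iff.2 (tendsto_id.const_mul_atTop hθ)
      simpa using (Real.tendsto_exp_atBot.comp h2).mul_const C
    refine squeeze_zero_norm (fun y => ?_) h1
    rw [norm_mul, Real.norm_of_nonneg (Real.exp_pos _).le]
    exact mul_le_mul_of_nonneg_left (hC y) (Real.exp_pos _).le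
  have key := integral_Ioi_of_hasDerivAt_of_tendsto' hder ((hI.const_mul (-θ)).add hI') hlim
  rw [integral_add (hI.const_mul (-θ)) hI', integral_const_mul] at key
  rw [integral_expMeasure hθ, integral_expMeasure hθ]
  simp only [mul_assoc]
  rw [integral_const_mul, integral_const_mul, inv_mul_cancel_left₀ hθ.ne']
  simp only [mul_zero, neg_zero, Real.exp_zero, one_mul, zero_sub] at key
  linarith

theorem integral_exp_neg_mul_expMeasure {γ a : ℝ} (hγ : 0 < γ) (ha : 0 ≤ a) :
    ∫ y, Real.exp (-(a * y)) ∂expMeasure γ = γ / (γ + a) := by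
  rw [integral_expMeasure hγ]
  have h1 : ∀ y : ℝ, γ * Real.exp (-(γ * y)) * Real.exp (-(a * y)) =
      γ * Real.exp (-(γ + a) * y) := fun y => by
    rw [mul_assoc, ← Real.exp_add]
    congr 2
    ring
  simp only [h1]
  rw [integral_const_mul, integral_exp_mul_Ioi (by linarith) 0]
  rw [mul_zero, Real.exp_zero, neg_div_neg_eq, mul_one_div]

theorem integral_div_expMeasure {α θ : ℝ} (hα : 0 < α) (hθ : 0 < θ) (h : ℝ → ℝ) :
    ∫ y, h (y / α) ∂expMeasure θ = ∫ y, h y ∂expMeasure (α * θ) := by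
  rw [integral_expMeasure hθ, integral_expMeasure (mul_pos hα hθ)]
  have h1 := integral_comp_mul_left_Ioi
    (fun y => α * θ * Real.exp (-(α * θ * y)) * h y) 0 (inv_pos.2 hα)
  rw [mul_zero, inv_inv, smul_eq_mul] at h1
  have h2 := congrArg (fun z => α⁻¹ * z) h1
  simp only [inv_mul_cancel_left₀ hα.ne'] at h2
  rw [← h2, ← integral_const_mul]
  refine integral_congr_ae (Eventually.of_forall fun y => ?_)
  simp only
  rw [show α * θ * (α⁻¹ * y) = θ * y by field_simp, div_eq_inv_mul]
  field_simp

/-! ### The deficit -/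

/-- The probability `P(t < T(∞) ≤ t + α ^ n E)`, where `E` is exponential with rate `d` and
independent of the weights. -/
def deficit (α : ℝ) (d n : ℕ) (t : ℝ) : ℝ :=
  survival α d t - ∫ y, survival α d (t + α ^ n * y) ∂expMeasure d

theorem isProbabilityMeasure_exp_natCast (hd : 2 ≤ d) :
    IsProbabilityMeasure (expMeasure (d : ℝ)) :=
  isProbabilityMeasure_expMeasure (by exact_mod_cast (by omega : 0 < d))

theorem measurable_survival_comp {X : Type*} [MeasurableSpace X] (α : ℝ) (d : ℕ) {f : X → ℝ}
    (hf : Measurable f) : Measurable fun x => survival α d (f x) :=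
  (measurable_survival α d).comp hf

theorem integrable_survival {X : Type*} [MeasurableSpace X] {ν : Measure X} [IsFiniteMeasure ν]
    (α : ℝ) (d : ℕ) {f : X → ℝ} (hf : Measurable f) :
    Integrable (fun x => survival α d (f x)) ν :=
  integrable_of_bound_one (measurable_survival_comp α d hf)
    (fun _ => survival_nonneg _ _ _) (fun _ => survival_le_one _ _ _)

theorem integrable_survival_pow {X : Type*} [MeasurableSpace X] {ν : Measure X}
    [IsFiniteMeasure ν] (α : ℝ) (d : ℕ) {f : X → ℝ} (hf : Measurable f) (k : ℕ) :
    Integrable (fun x => survival α d (f x) ^ k) ν :=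
  integrable_of_bound_one ((measurable_survival_comp α d hf).pow_const k)
    (fun _ => pow_nonneg (survival_nonneg _ _ _) _)
    (fun _ => pow_le_one₀ (survival_nonneg _ _ _) (survival_le_one _ _ _))

theorem ae_expMeasure_nonneg (r : ℝ) : ∀ᵐ y ∂expMeasure r, 0 ≤ y := by
  rw [ae_iff, expMeasure_eq]
  have : {y : ℝ | ¬ 0 ≤ y} = Set.Iio 0 := by
    ext y
    simp
  rw [this, withDensity_apply _ measurableSet_Iio]
  exact lintegral_exponentialPDF_of_nonpos le_rfl

theorem deficit_nonneg {α : ℝ} (h0 : 0 < α) (hd : 2 ≤ d) (n : ℕ) (t : ℝ) :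
    0 ≤ deficit α d n t := by
  have := isProbabilityMeasure_exp_natCast hd
  rw [deficit, sub_nonneg]
  have h1 : ∫ y, survival α d (t + α ^ n * y) ∂expMeasure d ≤
      ∫ _, survival α d t ∂expMeasure d := by
    refine integral_mono_ae (integrable_survival α d (by fun_prop)) (integrable_const _) ?_
    filter_upwards [ae_expMeasure_nonneg d] with y hy
    exact survival_antitone α d (by have := pow_pos h0 n; nlinarith)
  simpa using h1

/-- The hazard rate is at most one, so a clock of mean `α ^ n / d` rings after the explosion with
probability at most `α ^ n / d`. -/
theorem deficit_le {α : ℝ} (h0 : 0 < α) (hd : 2 ≤ d) (n : ℕ) (t : ℝ) :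
    deficit α d n t ≤ α ^ n / d * survival α d t := by
  have := isProbabilityMeasure_exp_natCast hd
  have hd0 : (0 : ℝ) < d := by exact_mod_cast (by omega : 0 < d)
  have hαn := pow_pos h0 n
  have h1 : ∫ y, Real.exp (-(α ^ n * y)) * survival α d t ∂expMeasure d ≤
      ∫ y, survival α d (t + α ^ n * y) ∂expMeasure d := by
    refine integral_mono_of_nonneg (Eventually.of_forall fun y =>
      mul_nonneg (Real.exp_pos _).le (survival_nonneg _ _ _))
      (integrable_survival α d (by fun_prop)) ?_
    filter_upwards [ae_expMeasure_nonneg d] with y hy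
    exact exp_neg_mul_survival_le h0 t (by positivity)
  rw [integral_mul_const, integral_exp_neg_mul_expMeasure hd0 hαn.le] at h1
  have hF := survival_nonneg α d t
  have h2 : 1 - (d : ℝ) / (d + α ^ n) ≤ α ^ n / d := by
    rw [one_sub_div (by positivity), add_sub_cancel_left]
    exact div_le_div_of_nonneg_left hαn.le hd0 (by linarith)
  rw [deficit]
  nlinarith

/-- The deficit of the minimum of `d` independent explosion times exceeds the deficit of a single
one, weighted by the survival of the other `d - 1`, by the factor `(d + a) / (1 + a)`. This comes
from the bound one on the hazard rate and is an equality if the hazard rate is constantly one. -/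
theorem pow_sub_integral_pow_ge {α : ℝ} (h0 : 0 < α) (hd : 2 ≤ d) (r : ℝ) {a : ℝ}
    (ha : 0 < a) :
    (d + a) / (1 + a) * (survival α d r ^ (d - 1) *
        (survival α d r - ∫ y, survival α d (r + a * y) ∂expMeasure d)) ≤
      survival α d r ^ d - ∫ y, survival α d (r + a * y) ^ d ∂expMeasure d := by
  have hprob := isProbabilityMeasure_exp_natCast hd
  have hd0 : (0 : ℝ) < d := by exact_mod_cast (by omega : 0 < d)
  obtain ⟨k, rfl⟩ : ∃ k, d = k + 1 := ⟨d - 1, by omega⟩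
  simp only [Nat.add_sub_cancel]
  set F := survival α (k + 1) with hF
  set z := F r with hz
  have hF0 : ∀ t, 0 ≤ F t := survival_nonneg _ _
  have hF1 : ∀ t, F t ≤ 1 := survival_le_one _ _
  have hc : Continuous F := continuous_survival h0
  set g : ℝ → ℝ := fun y => F (r + a * y) with hg
  set g' : ℝ → ℝ := fun y => (F ((r + a * y) / α) ^ (k + 1) - F (r + a * y)) * a with hg'
  have hder : ∀ y, HasDerivAt g (g' y) y := fun y => by
    have h1 : HasDerivAt (fun y => r + a * y) a y := by
      simpa using ((hasDerivAt_id y).const_mul a).const_add r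
    exact (hasDerivAt_survival (d := k + 1) h0 (r + a * y)).comp y h1
  have hg'c : Continuous g' := by fun_prop
  have hg0 : ∀ y, 0 ≤ g y := fun y => hF0 _
  have hg1 : ∀ y, g y ≤ 1 := fun y => hF1 _
  have hg'lo : ∀ y, -(a * g y) ≤ g' y := fun y => by
    have := pow_nonneg (hF0 ((r + a * y) / α)) (k + 1)
    simp only [hg', hg]
    nlinarith
  have hg'hi : ∀ y, g' y ≤ 0 := fun y =>
    mul_nonpos_of_nonpos_of_nonneg (sub_nonpos.2 (survival_pow_le h0 _)) ha.le
  -- integrate by parts the function `z ^ k * g - g ^ (k + 1) / (k + 1)`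
  have hY : ∀ y, HasDerivAt (fun y => z ^ k * g y - g y ^ (k + 1) / ((k + 1 : ℕ) : ℝ))
      (g' y * (z ^ k - g y ^ k)) y := fun y => by
    refine (((hder y).const_mul (z ^ k)).sub
      (((hder y).pow (k + 1)).div_const ((k + 1 : ℕ) : ℝ))).congr_deriv ?_
    rw [Nat.add_sub_cancel]
    field_simp
  have hgc : Continuous g := by fun_prop
  have hzk : ∀ y, |z ^ k - g y ^ k| ≤ 1 := fun y => by
    have h1 := pow_nonneg (hF0 r) k
    have h2 := pow_le_one₀ (n := k) (hF0 r) (hF1 r)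
    have h3 := pow_nonneg (hg0 y) k
    have h4 := pow_le_one₀ (n := k) (hg0 y) (hg1 y)
    rw [abs_le]
    constructor <;> linarith
  have ibp := integral_expMeasure_eq_add hd0 hY (by fun_prop) (C := 2) (C' := a)
    (fun y => by
      have h1 := mul_nonneg (pow_nonneg (hF0 r) k) (hg0 y)
      have h2 := mul_le_one₀ (pow_le_one₀ (n := k) (hF0 r) (hF1 r)) (hg0 y) (hg1 y)
      have h3 := pow_nonneg (hg0 y) (k + 1)
      have h4 := pow_le_one₀ (n := k + 1) (hg0 y) (hg1 y)
      have h5 : g y ^ (k + 1) / ((k + 1 : ℕ) : ℝ) ≤ 1 := by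
        rw [div_le_one hd0]
        have : (1 : ℝ) ≤ ((k + 1 : ℕ) : ℝ) := by exact_mod_cast (by omega : 1 ≤ k + 1)
        linarith
      have h6 : 0 ≤ g y ^ (k + 1) / ((k + 1 : ℕ) : ℝ) := by positivity
      rw [abs_le]
      constructor <;> linarith)
    (fun y => by
      rw [abs_mul]
      have h1 : |g' y| ≤ a := by
        rw [abs_of_nonpos (hg'hi y)]
        have := hg'lo y
        have := hg1 y
        nlinarith
      calc |g' y| * |z ^ k - g y ^ k| ≤ a * 1 :=
            mul_le_mul h1 (hzk y) (abs_nonneg _) ha.le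
        _ = a := mul_one a)
  have hIg : Integrable g (expMeasure ((k + 1 : ℕ) : ℝ)) :=
    integrable_survival α (k + 1) (by fun_prop)
  have hIgp : Integrable (fun y => g y ^ (k + 1)) (expMeasure ((k + 1 : ℕ) : ℝ)) :=
    integrable_survival_pow α (k + 1) (by fun_prop) _
  set p := ∫ y, g y ^ (k + 1) ∂expMeasure ((k + 1 : ℕ) : ℝ) with hp
  set q := ∫ y, g y ∂expMeasure ((k + 1 : ℕ) : ℝ) with hq
  have hmono : -a * (z ^ k * q - p) ≤
      ∫ y, g' y * (z ^ k - g y ^ k) ∂expMeasure ((k + 1 : ℕ) : ℝ) := by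
    rw [hp, hq, ← integral_const_mul, ← integral_sub (hIg.const_mul _) hIgp,
      ← integral_const_mul]
    refine integral_mono_ae (((hIg.const_mul _).sub hIgp).const_mul _) ?_ ?_
    · refine Integrable.of_bound (by fun_prop) a (Eventually.of_forall fun y => ?_)
      rw [norm_mul, Real.norm_eq_abs, Real.norm_eq_abs]
      have h1 : |g' y| ≤ a := by
        rw [abs_of_nonpos (hg'hi y)]
        have := hg'lo y
        have := hg1 y
        nlinarith
      calc |g' y| * |z ^ k - g y ^ k| ≤ a * 1 :=
            mul_le_mul h1 (hzk y) (abs_nonneg _) ha.le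
        _ = a := mul_one a
    · filter_upwards [ae_expMeasure_nonneg ((k + 1 : ℕ) : ℝ)] with y hy
      have h1 : g y ≤ z := survival_antitone α (k + 1) (by nlinarith)
      have h2 : g y ^ k ≤ z ^ k := pow_le_pow_left₀ (hg0 y) h1 k
      have h3 := hg'lo y
      have h4 : -(a * g y) * (z ^ k - g y ^ k) ≤ g' y * (z ^ k - g y ^ k) :=
        mul_le_mul_of_nonneg_right h3 (sub_nonneg.2 h2)
      refine le_trans (le_of_eq ?_) h4
      ring
  rw [integral_sub (hIg.const_mul _) (hIgp.div_const _), integral_const_mul,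
    integral_div, ← hp, ← hq] at ibp
  have hgz : g 0 = z := by simp [hg, hz]
  rw [hgz] at ibp
  have h5 : ((k + 1 : ℕ) : ℝ) * (z ^ k * q) - p =
      ((k + 1 : ℕ) : ℝ) * (z ^ k * z) - z ^ (k + 1) +
        ∫ y, g' y * (z ^ k - g y ^ k) ∂expMeasure ((k + 1 : ℕ) : ℝ) := by
    field_simp at ibp
    linarith
  rw [pow_succ z k] at h5 ⊢
  rw [div_mul_eq_mul_div, div_le_iff₀ (by linarith)]
  nlinarith

/-- The renewal inequality for the deficit: by self-similarity, waiting `α ^ (n + 1) * E` after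
time `t` is waiting `α ^ n * E` in the subtrees above the children of the root. -/
theorem deficit_succ_ge {α : ℝ} (h0 : 0 < α) (hd : 2 ≤ d) (n : ℕ) (t : ℝ) :
    (d + α ^ n) / (1 + α ^ n) *
        ∫ s, survival α d ((t - s) / α) ^ (d - 1) * deficit α d n ((t - s) / α) ∂expMeasure 1 ≤
      deficit α d (n + 1) t := by
  have hprob := isProbabilityMeasure_exp_natCast hd
  have hαn := pow_pos h0 n
  have h1 : ∀ y, survival α d (t + α ^ (n + 1) * y) =
      ∫ s, survival α d ((t - s) / α + α ^ n * y) ^ d ∂expMeasure 1 := fun y => by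
    rw [survival_eq h0]
    refine integral_congr_ae (Eventually.of_forall fun s => ?_)
    simp only
    congr 2
    rw [pow_succ]
    field_simp
    ring
  have hI : Integrable (Function.uncurry fun y s =>
      survival α d ((t - s) / α + α ^ n * y) ^ d)
      ((expMeasure (d : ℝ)).prod (expMeasure 1)) :=
    integrable_survival_pow α d (f := fun q : ℝ × ℝ => (t - q.2) / α + α ^ n * q.1)
      (by fun_prop) d
  have hI' : Integrable (fun s => ∫ y, survival α d ((t - s) / α + α ^ n * y) ^ d
      ∂expMeasure d) (expMeasure 1) := hI.integral_prod_right
  rw [deficit]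
  simp only [h1]
  rw [integral_integral_swap hI, survival_eq h0 t, ← integral_sub
    (integrable_survival_pow α d (by fun_prop) d) hI', ← integral_const_mul]
  refine integral_mono_of_nonneg (Eventually.of_forall fun s => ?_) ?_
    (Eventually.of_forall fun s => pow_sub_integral_pow_ge h0 hd _ hαn)
  · exact mul_nonneg (by positivity)
      (mul_nonneg (pow_nonneg (survival_nonneg _ _ _) _) (deficit_nonneg h0 hd _ _))
  · exact (integrable_survival_pow α d (by fun_prop) d).sub hI'

/-- Before time `t ≥ 0` the root may be dry with probability `exp (-t)`, and then the percolation
restarts at time `t`. -/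
theorem exp_neg_mul_deficit_zero_le {α : ℝ} (h0 : 0 < α) (hd : 2 ≤ d) {t : ℝ} (ht : 0 ≤ t) :
    Real.exp (-t) * deficit α d 0 0 ≤ deficit α d 0 t := by
  have hprob := isProbabilityMeasure_exp_natCast hd
  have hmono : ∀ y, 0 ≤ y → Monotone fun t =>
      Real.exp t * survival α d t - Real.exp t * survival α d (t + y) := fun y hy => by
    have h1 : (fun t => Real.exp t * survival α d t - Real.exp t * survival α d (t + y)) =
        fun t => Real.exp t * survival α d t -
          Real.exp (-y) * (Real.exp (t + y) * survival α d (t + y)) := by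
      ext t
      rw [← mul_assoc (Real.exp (-y)), ← Real.exp_add]
      congr 3
      ring_nf
    rw [h1]
    refine monotone_of_hasDerivAt_nonneg (fun t => (hasDerivAt_exp_mul_survival h0 t).sub
      (((hasDerivAt_exp_mul_survival h0 (t + y)).comp_add_const t y).const_mul _)) fun t => ?_
    rw [Pi.zero_apply, ← mul_assoc, ← Real.exp_add, sub_nonneg]
    have h2 : -y + (t + y) = t := by ring
    rw [h2]
    refine mul_le_mul_of_nonneg_left (pow_le_pow_left₀ (survival_nonneg _ _ _)
      (survival_antitone α d ?_) d) (Real.exp_pos _).le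
    gcongr
    linarith
  have h3 : ∀ s, deficit α d 0 s =
      ∫ y, (survival α d s - survival α d (s + y)) ∂expMeasure d := fun s => by
    rw [integral_sub (integrable_const _) (integrable_survival α d (by fun_prop)), deficit]
    simp
  rw [h3, h3, ← integral_const_mul]
  refine integral_mono_ae (((integrable_const _).sub
    (integrable_survival α d (by fun_prop))).const_mul _)
    ((integrable_const _).sub (integrable_survival α d (by fun_prop))) ?_
  filter_upwards [ae_expMeasure_nonneg d] with y hy
  have h4 := mul_le_mul_of_nonneg_left (hmono y hy ht) (Real.exp_pos (-t)).le
  simp only [Real.exp_zero, one_mul] at h4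
  refine h4.trans_eq ?_
  rw [← mul_sub, ← mul_assoc, ← Real.exp_add, neg_add_cancel, Real.exp_zero, one_mul]

/-- Memorylessness of the clock: the clock outlasts the time `-t` during which nothing can happen
with probability `exp (d * t)`. -/
theorem deficit_zero_of_nonpos {α : ℝ} (hd : 2 ≤ d) {t : ℝ} (ht : t ≤ 0) :
    deficit α d 0 t = Real.exp (d * t) * deficit α d 0 0 := by
  have hprob := isProbabilityMeasure_exp_natCast hd
  have hd0 : (0 : ℝ) < d := by exact_mod_cast (by omega : 0 < d)
  set k : ℝ → ℝ := (Set.Ioi (0 : ℝ)).indicator fun z =>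
    d * Real.exp (-(d * z)) * (1 - survival α d z) with hk
  have h1 : ∀ s, s ≤ 0 → deficit α d 0 s = Real.exp (d * s) * ∫ z, k z := fun s hs => by
    have h2 : deficit α d 0 s = ∫ y, (1 - survival α d (s + y)) ∂expMeasure d := by
      rw [integral_sub (integrable_const _) (integrable_survival α d (by fun_prop)), deficit,
        survival_of_nonpos α hs]
      simp
    rw [h2, integral_expMeasure hd0, ← integral_indicator measurableSet_Ioi,
      ← integral_add_left_eq_self k s, ← integral_const_mul]
    refine integral_congr_ae (Eventually.of_forall fun y => ?_)
    simp only [hk]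
    by_cases hy : 0 < s + y
    · have hy' : 0 < y := by linarith
      simp only [Set.indicator_of_mem (Set.mem_Ioi.2 hy), Set.indicator_of_mem (Set.mem_Ioi.2 hy')]
      have : Real.exp (-(d * y)) = Real.exp (d * s) * Real.exp (-(d * (s + y))) := by
        rw [← Real.exp_add]
        congr 1
        ring
      rw [this]
      ring
    · rw [Set.indicator_of_notMem (s := Set.Ioi (0 : ℝ)) (a := s + y) (by simpa using hy),
        mul_zero]
      refine Set.indicator_apply_eq_zero.2 fun _ => ?_
      rw [survival_of_nonpos α (not_lt.1 hy), sub_self, mul_zero]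
  rw [h1 t ht, h1 0 le_rfl, mul_zero, Real.exp_zero, one_mul]

/-! ### A lower bound for the deficit at time zero -/

/-- The Laplace transform at `θ` of the smallest of `d` independent explosion times. -/
def minLaplace (α : ℝ) (d : ℕ) (θ : ℝ) : ℝ :=
  1 - ∫ y, survival α d y ^ d ∂expMeasure θ

/-- The smallest explosion time above the children is at most the smallest weight among the
children, which is exponential with rate `d`, plus `α` times an independent copy of itself.
Iterating this means following the path that always chooses the child with the smallest weight. -/
theorem minLaplace_mul_le {α θ : ℝ} (h0 : 0 < α) (hd : 2 ≤ d) (hθ : 0 < θ) :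
    minLaplace α d (α * θ) ≤ (1 + θ / d) * minLaplace α d θ := by
  have hprob := isProbabilityMeasure_expMeasure hθ
  have hd0 : (0 : ℝ) < d := by exact_mod_cast (by omega : 0 < d)
  have hc := continuous_survival (d := d) h0
  have hF0 := survival_nonneg α d
  have hF1 := survival_le_one α d
  have hder : ∀ y, HasDerivAt (fun y => survival α d y ^ d)
      (d * survival α d y ^ (d - 1) * (survival α d (y / α) ^ d - survival α d y)) y :=
    fun y => (hasDerivAt_survival h0 y).pow d
  have hpw : ∀ y, survival α d y ^ (d - 1) * survival α d y = survival α d y ^ d := fun y =>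
    pow_sub_one_mul (by omega) _
  have hI1 : Integrable (fun y => survival α d (y / α) ^ d) (expMeasure θ) :=
    integrable_survival_pow α d (by fun_prop) d
  have hI2 : Integrable (fun y => survival α d y ^ d) (expMeasure θ) :=
    integrable_survival_pow α d measurable_id d
  have hle1 : ∀ y, survival α d y ^ (d - 1) ≤ 1 := fun y => pow_le_one₀ (hF0 y) (hF1 y)
  have hp0 : ∀ y k, 0 ≤ survival α d y ^ k := fun y k => pow_nonneg (hF0 y) k
  have hbd : ∀ y, |d * survival α d y ^ (d - 1) *
      (survival α d (y / α) ^ d - survival α d y)| ≤ d := fun y => by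
    have h1 : |survival α d (y / α) ^ d - survival α d y| ≤ 1 := by
      have h2 := hp0 (y / α) d
      have h3 := survival_pow_le (d := d) h0 y
      have h4 := hF1 y
      rw [abs_le]
      constructor <;> linarith
    rw [abs_mul, abs_of_nonneg (mul_nonneg hd0.le (hp0 _ _))]
    calc d * survival α d y ^ (d - 1) * |survival α d (y / α) ^ d - survival α d y|
        ≤ d * 1 * 1 := by
          gcongr
          exact hle1 y
      _ = d := by ring
  have ibp := integral_expMeasure_eq_add hθ hder (by fun_prop) (C := 1)
    (fun y => by
      rw [abs_of_nonneg (hp0 y d)]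
      exact pow_le_one₀ (hF0 y) (hF1 y)) hbd
  have hmono : ∫ y, d * survival α d y ^ (d - 1) *
      (survival α d (y / α) ^ d - survival α d y) ∂expMeasure θ ≤
      ∫ y, d * (survival α d (y / α) ^ d - survival α d y ^ d) ∂expMeasure θ := by
    refine integral_mono (Integrable.of_bound (by fun_prop) (d : ℝ)
      (Eventually.of_forall hbd)) ((hI1.sub hI2).const_mul _) fun y => ?_
    have h1 : survival α d y ^ (d - 1) * survival α d (y / α) ^ d ≤ survival α d (y / α) ^ d :=
      mul_le_of_le_one_left (hp0 _ _) (hle1 y)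
    calc d * survival α d y ^ (d - 1) * (survival α d (y / α) ^ d - survival α d y)
        = d * (survival α d y ^ (d - 1) * survival α d (y / α) ^ d -
            survival α d y ^ (d - 1) * survival α d y) := by ring
      _ ≤ _ := by
        rw [hpw]
        gcongr
  rw [integral_const_mul, integral_sub hI1 hI2,
    integral_div_expMeasure h0 hθ (fun y => survival α d y ^ d)] at hmono
  rw [survival_of_nonpos α le_rfl, one_pow] at ibp
  simp only [minLaplace]
  set m := ∫ y, survival α d y ^ d ∂expMeasure θ
  set m' := ∫ y, survival α d y ^ d ∂expMeasure (α * θ)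
  have h2 : m ≤ 1 + θ⁻¹ * (d * (m' - m)) := by
    refine ibp.le.trans ?_
    gcongr
  have h3 : θ * m ≤ θ + d * (m' - m) := by
    have := mul_le_mul_of_nonneg_left h2 hθ.le
    rwa [mul_add, mul_one, mul_inv_cancel_left₀ hθ.ne'] at this
  have h4 : d * (1 - m') ≤ (d + θ) * (1 - m) := by linarith
  have h5 : (1 + θ / d) * (1 - m) = (d + θ) * (1 - m) / d := by
    field_simp
  rw [h5, le_div_iff₀ hd0]
  linarith

theorem one_sub_le_minLaplace {α θ : ℝ} (h0 : 0 < α) (h1 : α < 1) (hd : 2 ≤ d) (hθ : 0 < θ) :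
    1 - tailConst α d * θ ≤ minLaplace α d θ := by
  have hle : ∫ y, survival α d y ^ d ∂expMeasure θ ≤ θ * tailConst α d := by
    have hc := one_le_tailConst h0 h1 hd
    have hI : IntegrableOn (fun y : ℝ => Real.exp (-y)) (Set.Ioi 0) := by
      simpa using integrableOn_exp_mul_Ioi (a := -1) (by norm_num) 0
    rw [integral_expMeasure hθ]
    calc ∫ y in Set.Ioi 0, θ * Real.exp (-(θ * y)) * survival α d y ^ d
        ≤ ∫ y in Set.Ioi 0, θ * tailConst α d * Real.exp (-y) := by
          refine integral_mono_of_nonneg ?_ (hI.const_mul _) ?_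
          · exact Eventually.of_forall fun y =>
              mul_nonneg (by positivity) (pow_nonneg (survival_nonneg _ _ _) _)
          · filter_upwards [ae_restrict_mem measurableSet_Ioi] with y hy
            have h2 : Real.exp (-(θ * y)) ≤ 1 := by
              rw [Real.exp_le_one_iff]
              have := mul_pos hθ (Set.mem_Ioi.1 hy)
              linarith
            have h3 : survival α d y ^ d ≤ survival α d y :=
              pow_le_of_le_one (survival_nonneg _ _ _) (survival_le_one _ _ _) (by omega)
            have h4 := h3.trans (survival_le_tailConst_mul h0 h1 hd y)
            calc θ * Real.exp (-(θ * y)) * survival α d y ^ d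
                ≤ θ * 1 * (tailConst α d * Real.exp (-y)) := by
                  gcongr
                  exact pow_nonneg (survival_nonneg _ _ _) _
              _ = _ := by ring
      _ = θ * tailConst α d := by
          have := integral_exp_neg_Ioi 0
          rw [integral_const_mul, this]
          simp
  rw [minLaplace]
  linarith

theorem minLaplace_pow_le {α : ℝ} (h0 : 0 < α) (hd : 2 ≤ d) (n : ℕ) :
    minLaplace α d (d * α ^ (n + 1)) ≤
      (∏ k ∈ Finset.range n, (1 + α ^ (k + 1))) * minLaplace α d (d * α) := by
  have hd0 : (0 : ℝ) < d := by exact_mod_cast (by omega : 0 < d)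
  induction n with
  | zero => simp
  | succ n ih =>
    have h1 := minLaplace_mul_le h0 hd (θ := d * α ^ (n + 1)) (by positivity)
    rw [show α * (d * α ^ (n + 1)) = d * α ^ (n + 1 + 1) by ring,
      mul_div_cancel_left₀ _ hd0.ne'] at h1
    rw [Finset.prod_range_succ]
    refine h1.trans ?_
    calc (1 + α ^ (n + 1)) * minLaplace α d (d * α ^ (n + 1))
        ≤ (1 + α ^ (n + 1)) * ((∏ k ∈ Finset.range n, (1 + α ^ (k + 1))) *
            minLaplace α d (d * α)) := by gcongr
      _ = _ := by ring

theorem one_add_mul_deficit_zero {α : ℝ} (h0 : 0 < α) (hd : 2 ≤ d) :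
    (1 + d) * deficit α d 0 0 = minLaplace α d (d * α) := by
  have hprob := isProbabilityMeasure_exp_natCast hd
  have hd0 : (0 : ℝ) < d := by exact_mod_cast (by omega : 0 < d)
  have hc := continuous_survival (d := d) h0
  have hI1 : Integrable (fun y => survival α d (y / α) ^ d) (expMeasure (d : ℝ)) :=
    integrable_survival_pow α d (by fun_prop) d
  have hI2 : Integrable (fun y => survival α d y) (expMeasure (d : ℝ)) :=
    integrable_survival α d measurable_id
  have ibp := integral_expMeasure_eq_add hd0 (hasDerivAt_survival (d := d) h0) (by fun_prop)
    (C := 1) (C' := 1)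
    (fun y => by
      rw [abs_of_nonneg (survival_nonneg _ _ _)]
      exact survival_le_one _ _ _)
    (fun y => by
      have h2 := pow_nonneg (survival_nonneg α d (y / α)) d
      have h3 := survival_pow_le (d := d) h0 y
      have h4 := survival_le_one α d y
      rw [abs_le]
      constructor <;> linarith)
  rw [integral_sub hI1 hI2, integral_div_expMeasure h0 hd0 (fun y => survival α d y ^ d),
    survival_of_nonpos α le_rfl, mul_comm α] at ibp
  rw [deficit, minLaplace, survival_of_nonpos α le_rfl]
  simp only [pow_zero, one_mul, zero_add]
  field_simp at ibp
  linarith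

theorem one_le_mul_deficit_zero {α : ℝ} (h0 : 0 < α) (h1 : α < 1) (hd : 2 ≤ d) {Q : ℝ}
    (hQ : ∀ n, ∏ k ∈ Finset.range n, (1 + α ^ (k + 1)) ≤ Q) :
    1 ≤ Q * ((1 + d) * deficit α d 0 0) := by
  have hd0 : (0 : ℝ) < d := by exact_mod_cast (by omega : 0 < d)
  rw [one_add_mul_deficit_zero h0 hd]
  have hpos : 0 ≤ minLaplace α d (d * α) := by
    rw [← one_add_mul_deficit_zero h0 hd]
    exact mul_nonneg (by positivity) (deficit_nonneg h0 hd _ _)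
  have hle : ∀ n : ℕ, 1 - tailConst α d * (d * α ^ (n + 1)) ≤ Q * minLaplace α d (d * α) :=
    fun n => (one_sub_le_minLaplace h0 h1 hd (by positivity)).trans
      ((minLaplace_pow_le h0 hd n).trans (mul_le_mul_of_nonneg_right (hQ n) hpos))
  have hlim : Tendsto (fun n : ℕ => 1 - tailConst α d * (d * α ^ (n + 1))) atTop
      (𝓝 (1 - tailConst α d * (d * 0))) :=
    (((((tendsto_pow_atTop_nhds_zero_of_lt_one h0.le h1).comp (tendsto_add_atTop_nat 1)).const_mul
      (d : ℝ)).const_mul (tailConst α d)).const_sub 1)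
  have := le_of_tendsto' hlim hle
  simpa using this

/-! ### The explicit constants -/

theorem prod_le_eulerProd {α : ℝ} (h0 : 0 < α) (h1 : α < 1) (n : ℕ) :
    ∏ k ∈ Finset.range n, (1 - α ^ (k + 1))⁻¹ ≤ eulerProd α := by
  have hone : ∀ k : ℕ, 1 ≤ (1 - α ^ (k + 1))⁻¹ := fun k => by
    have h2 : α ^ (k + 1) < 1 := pow_lt_one₀ h0.le h1 (Nat.succ_ne_zero k)
    have h3 : 0 < α ^ (k + 1) := by positivity
    exact (one_le_inv₀ (by linarith)).2 (by linarith)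
  have hmono : Monotone fun n => ∏ k ∈ Finset.range n, (1 - α ^ (k + 1))⁻¹ :=
    monotone_nat_of_le_succ fun n => by
      rw [Finset.prod_range_succ]
      refine le_mul_of_one_le_right (Finset.prod_nonneg fun k _ => ?_) (hone n)
      exact zero_le_one.trans (hone k)
  exact hmono.ge_of_tendsto (multipliable_eulerProd h0 h1).hasProd.tendsto_prod_nat n

theorem prod_one_add_pow_le {α : ℝ} (h0 : 0 < α) (h1 : α < 1) (n : ℕ) :
    ∏ k ∈ Finset.range n, (1 + α ^ (k + 1)) ≤ (1 - α ^ 2) * eulerProd α := by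
  have hlt : ∀ k : ℕ, α ^ (k + 1) < 1 := fun k => pow_lt_one₀ h0.le h1 (Nat.succ_ne_zero k)
  have hα2 : α ^ 2 < 1 := hlt 1
  have hmain : ∀ n, ∏ k ∈ Finset.range (n + 1), (1 + α ^ (k + 1)) ≤
      (1 - α ^ 2) * ∏ k ∈ Finset.range (n + 1), (1 - α ^ (k + 1))⁻¹ := fun n => by
    induction n with
    | zero =>
      simp only [zero_add, Finset.prod_range_one, pow_one]
      rw [← div_eq_mul_inv, le_div_iff₀ (by linarith)]
      nlinarith
    | succ n ih =>
      rw [Finset.prod_range_succ, Finset.prod_range_succ _ (n + 1), ← mul_assoc]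
      have h2 := hlt (n + 1)
      have h3 : 0 < α ^ (n + 1 + 1) := by positivity
      refine mul_le_mul ih ?_ (by positivity) ?_
      · rw [← one_div, le_div_iff₀ (by linarith)]
        nlinarith
      · refine mul_nonneg (by linarith) (Finset.prod_nonneg fun k _ => ?_)
        exact inv_nonneg.2 (by linarith [hlt k])
  calc ∏ k ∈ Finset.range n, (1 + α ^ (k + 1))
      ≤ ∏ k ∈ Finset.range (n + 1), (1 + α ^ (k + 1)) := by
        rw [Finset.prod_range_succ]
        exact le_mul_of_one_le_right (by positivity) (by linarith [pow_pos h0 (n + 1)])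
    _ ≤ (1 - α ^ 2) * ∏ k ∈ Finset.range (n + 1), (1 - α ^ (k + 1))⁻¹ := hmain n
    _ ≤ _ := mul_le_mul_of_nonneg_left (prod_le_eulerProd h0 h1 _) (by linarith)

theorem two_mul_sq_le_laplaceConst {α : ℝ} (h0 : 0 < α) (h1 : α < 1) (hd : 2 ≤ d) :
    2 * ((1 - α ^ 2) * eulerProd α) ^ 2 ≤ laplaceConst α (d - α) d := by
  have hd2 : (2 : ℝ) ≤ d := by exact_mod_cast hd
  have hexp : 1 ≤ Real.exp (((d : ℝ) * (d - 1) / 2 - 1) / ((d - α) * (1 - α))) := by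
    refine Real.one_le_exp (div_nonneg ?_ (mul_nonneg ?_ ?_)) <;> nlinarith
  have hdd : 4 ≤ (d : ℝ) ^ 2 * ((d : ℝ) - 1)⁻¹ := by
    rw [← div_eq_mul_inv, le_div_iff₀ (by linarith)]
    nlinarith [sq_nonneg ((d : ℝ) - 2)]
  have hs : 0 ≤ eulerProd α ^ 2 := sq_nonneg _
  have h2 : 2 * (1 - α ^ 2) ^ 2 ≤ 4 * (1 - α) := by
    have h3 : (1 - α) * (1 + α) ^ 2 ≤ 2 := by nlinarith [mul_pos h0 h0]
    have h4 : (1 - α ^ 2) ^ 2 = (1 - α) * ((1 - α) * (1 + α) ^ 2) := by ring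
    rw [h4]
    nlinarith
  unfold laplaceConst
  calc 2 * ((1 - α ^ 2) * eulerProd α) ^ 2 = 2 * (1 - α ^ 2) ^ 2 * eulerProd α ^ 2 := by ring
    _ ≤ 4 * (1 - α) * eulerProd α ^ 2 := mul_le_mul_of_nonneg_right h2 hs
    _ ≤ (d : ℝ) ^ 2 * ((d : ℝ) - 1)⁻¹ * (1 - α) * eulerProd α ^ 2 := by
        gcongr
    _ ≤ _ := le_mul_of_one_le_right (mul_nonneg (mul_nonneg (by linarith) (by linarith)) hs) hexp

/-- The accumulated loss factor `∏ (1 + α ^ j) / (d + α ^ j)` over the levels below `n`. -/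
def lossFactor (α : ℝ) (d n : ℕ) : ℝ := ∏ j ∈ Finset.range n, (1 + α ^ j) / (d + α ^ j)

theorem lossFactor_pos {α : ℝ} (h0 : 0 < α) (d n : ℕ) : 0 < lossFactor α d n :=
  Finset.prod_pos fun j _ => by positivity

/-- The loss factor cancels the number `d ^ n` of vertices of level `n` up to a constant. -/
theorem pow_mul_lossFactor_le {α : ℝ} (h0 : 0 < α) (hd : 2 ≤ d) {Q : ℝ}
    (hQ : ∀ n, ∏ k ∈ Finset.range n, (1 + α ^ (k + 1)) ≤ Q) (n : ℕ) :
    (d : ℝ) ^ n * lossFactor α d n ≤ 2 * d / (d + 1) * Q := by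
  have hd2 : (2 : ℝ) ≤ d := by exact_mod_cast hd
  have h1 : (d : ℝ) ^ n * lossFactor α d n =
      ∏ j ∈ Finset.range n, d * ((1 + α ^ j) / (d + α ^ j)) := by
    rw [Finset.prod_mul_distrib, Finset.prod_const, Finset.card_range, lossFactor]
  have h2 : 1 ≤ 2 * (d : ℝ) / (d + 1) := by
    rw [le_div_iff₀ (by linarith)]
    linarith
  rw [h1]
  cases n with
  | zero =>
    have := hQ 0
    simp only [Finset.range_zero, Finset.prod_empty] at this ⊢
    nlinarith
  | succ n =>
    rw [Finset.prod_range_succ', mul_comm]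
    refine mul_le_mul ?_ (le_trans (Finset.prod_le_prod (fun j _ => by positivity)
      fun j _ => ?_) (hQ n)) (Finset.prod_nonneg fun j _ => by positivity) (by positivity)
    · refine le_of_eq ?_
      rw [pow_zero]
      ring
    · have h3 : 0 < α ^ (j + 1) := by positivity
      rw [← mul_div_assoc, div_le_iff₀ (by positivity)]
      nlinarith

/-! ### Hitting probabilities -/

theorem measurable_deficit {α : ℝ} (hd : 2 ≤ d) (n : ℕ) : Measurable (deficit α d n) := by
  have hprob := isProbabilityMeasure_exp_natCast hd
  have h1 : Antitone fun t => ∫ y, survival α d (t + α ^ n * y) ∂expMeasure d := fun s t hst =>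
    integral_mono (integrable_survival α d (by fun_prop)) (integrable_survival α d (by fun_prop))
      fun y => survival_antitone α d (by linarith)
  exact (measurable_survival α d).sub h1.measurable

/-- Hitting probabilities and deficits satisfy the same renewal relation up to the factors that
are accumulated in `lossFactor`, so a comparison at the root carries over to all vertices. -/
theorem hitProb_le_deficit {α : ℝ} (h0 : 0 < α) (hd : 2 ≤ d) {M : ℝ} (hM : 0 ≤ M)
    (x : Vertex d) {W : Set ℝ} (hW : MeasurableSet W)
    (hbase : ∀ r, hitProb α ((fun w => α ^ x.length * w) ⁻¹' W) ([] : Vertex d) r ≤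
      ENNReal.ofReal (M * deficit α d 0 r)) (t : ℝ) :
    hitProb α W x t ≤
      ENNReal.ofReal (M * lossFactor α d x.length * deficit α d x.length t) := by
  induction x generalizing W t with
  | nil => simpa [lossFactor] using hbase t
  | cons i y ih =>
    set n := y.length with hn
    have hαn := pow_pos h0 n
    have hd0 : (0 : ℝ) < d := by exact_mod_cast (by omega : 0 < d)
    have hih := fun s => ih (W := (fun w => α * w) ⁻¹' W) (hW.preimage (by fun_prop)) (fun r => by
      have h1 := hbase r
      have h2 : (fun w => α ^ (i :: y).length * w) ⁻¹' W =
          (fun w => α ^ n * w) ⁻¹' ((fun w => α * w) ⁻¹' W) := by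
        ext w
        simp only [Set.mem_preimage, List.length_cons, ← hn, pow_succ]
        ring_nf
      rwa [h2] at h1) s
    have hL := (lossFactor_pos h0 d n).le
    have hI : Integrable (fun s => survival α d ((t - s) / α) ^ (d - 1) *
        deficit α d n ((t - s) / α)) (expMeasure 1) := by
      refine Integrable.of_bound (C := α ^ n / d) (((measurable_survival_comp α d
        (by fun_prop)).pow_const _).mul ((measurable_deficit hd n).comp
        (by fun_prop))).aestronglyMeasurable (Eventually.of_forall fun s => ?_)
      have h1 := deficit_nonneg h0 hd n ((t - s) / α)
      have h2 := survival_nonneg α d ((t - s) / α)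
      have h3 := survival_le_one α d ((t - s) / α)
      have h4 := deficit_le h0 hd n ((t - s) / α)
      rw [Real.norm_of_nonneg (mul_nonneg (pow_nonneg h2 _) h1)]
      calc survival α d ((t - s) / α) ^ (d - 1) * deficit α d n ((t - s) / α)
          ≤ 1 * (α ^ n / d * 1) := by
            refine mul_le_mul (pow_le_one₀ h2 h3) (h4.trans ?_) h1 zero_le_one
            gcongr
        _ = α ^ n / d := by ring
    rw [hitProb_cons h0 hW]
    calc ∫⁻ s, hitProb α ((fun w => α * w) ⁻¹' W) y ((t - s) / α) *
          weightLaw d (surviving α ((t - s) / α)) ^ (d - 1) ∂expMeasure 1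
        ≤ ∫⁻ s, ENNReal.ofReal (M * lossFactor α d n * (survival α d ((t - s) / α) ^ (d - 1) *
            deficit α d n ((t - s) / α))) ∂expMeasure 1 := by
          refine lintegral_mono fun s => ?_
          rw [← ofReal_survival, ← ENNReal.ofReal_pow (survival_nonneg _ _ _)]
          refine (mul_le_mul_left (hih _) _).trans_eq ?_
          rw [← ENNReal.ofReal_mul (mul_nonneg (mul_nonneg hM hL) (deficit_nonneg h0 hd _ _))]
          congr 1
          ring
      _ = ENNReal.ofReal (M * lossFactor α d n *
            ∫ s, survival α d ((t - s) / α) ^ (d - 1) *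
              deficit α d n ((t - s) / α) ∂expMeasure 1) := by
          rw [← integral_const_mul, ofReal_integral_eq_lintegral_ofReal (hI.const_mul _)]
          exact Eventually.of_forall fun s => mul_nonneg (mul_nonneg hM hL)
            (mul_nonneg (pow_nonneg (survival_nonneg _ _ _) _) (deficit_nonneg h0 hd _ _))
      _ ≤ _ := by
          refine ENNReal.ofReal_le_ofReal ?_
          have h1 := deficit_succ_ge h0 hd n t
          have h2 : ∫ s, survival α d ((t - s) / α) ^ (d - 1) *
              deficit α d n ((t - s) / α) ∂expMeasure 1 ≤
              (1 + α ^ n) / (d + α ^ n) * deficit α d (n + 1) t := by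
            rw [div_mul_eq_mul_div, div_le_iff₀ (by positivity)] at h1
            rw [div_mul_eq_mul_div, le_div_iff₀ (by positivity)]
            linarith
          have hls : lossFactor α d (n + 1) = lossFactor α d n * ((1 + α ^ n) / (d + α ^ n)) :=
            Finset.prod_range_succ _ _
          rw [List.length_cons, ← hn, hls]
          calc _ ≤ M * lossFactor α d n *
                ((1 + α ^ n) / (d + α ^ n) * deficit α d (n + 1) t) :=
                mul_le_mul_of_nonneg_left h2 (mul_nonneg hM hL)
            _ = _ := by ring

/-- A bound on the probability that the root gets wet in a rescaled time window, relative to the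
deficit at level zero, carries over to all levels with the constant `laplaceConst`. -/
theorem hitProb_le {α : ℝ} (h0 : 0 < α) (h1 : α < 1) (hd : 2 ≤ d) {M : ℝ} (hM : 0 ≤ M)
    (x : Vertex d) {W : Set ℝ} (hW : MeasurableSet W)
    (hbase : ∀ r, hitProb α ((fun w => α ^ x.length * w) ⁻¹' W) ([] : Vertex d) r ≤
      ENNReal.ofReal (M * (deficit α d 0 r / deficit α d 0 0))) (t : ℝ) :
    (d : ENNReal) ^ x.length * hitProb α W x t ≤
      ENNReal.ofReal (M * laplaceConst α (d - α) d * α ^ x.length * survival α d t) := by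
  set n := x.length with hn
  have hd0 : (0 : ℝ) < d := by exact_mod_cast (by omega : 0 < d)
  set Q := (1 - α ^ 2) * eulerProd α with hQdef
  have hQ : ∀ n, ∏ k ∈ Finset.range n, (1 + α ^ (k + 1)) ≤ Q := prod_one_add_pow_le h0 h1
  have hQ1 : 1 ≤ Q := by simpa using hQ 0
  have hD1 := one_le_mul_deficit_zero h0 h1 hd hQ
  have hD0 : 0 < deficit α d 0 0 := by
    refine lt_of_le_of_ne (deficit_nonneg h0 hd 0 0) fun h => ?_
    rw [← h] at hD1
    norm_num at hD1
  have hDinv : 1 / deficit α d 0 0 ≤ Q * (1 + d) := by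
    rw [div_le_iff₀ hD0]
    linarith
  have key := hitProb_le_deficit h0 hd (M := M / deficit α d 0 0) (by positivity) x hW
    (fun r => (hbase r).trans_eq (by congr 1; ring)) t
  rw [← hn] at key
  have hcast : ((d : ENNReal)) ^ n = ENNReal.ofReal ((d : ℝ) ^ n) := by
    rw [ENNReal.ofReal_pow hd0.le, ENNReal.ofReal_natCast]
  rw [hcast]
  refine (mul_le_mul_right key _).trans ?_
  rw [← ENNReal.ofReal_mul (by positivity)]
  refine ENNReal.ofReal_le_ofReal ?_
  have hF := survival_nonneg α d t
  have hL := pow_mul_lossFactor_le h0 hd hQ n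
  have hLpos := lossFactor_pos h0 d n
  calc (d : ℝ) ^ n * (M / deficit α d 0 0 * lossFactor α d n * deficit α d n t)
      = M * (1 / deficit α d 0 0) * ((d : ℝ) ^ n * lossFactor α d n) * deficit α d n t := by ring
    _ ≤ M * (Q * (1 + d)) * (2 * d / (d + 1) * Q) * (α ^ n / d * survival α d t) := by
        refine mul_le_mul ?_ (deficit_le h0 hd n t) (deficit_nonneg h0 hd n t) (by positivity)
        refine mul_le_mul (mul_le_mul_of_nonneg_left hDinv hM) hL (by positivity) (by positivity)
    _ = M * (2 * Q ^ 2) * α ^ n * survival α d t := by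
        field_simp
        ring
    _ ≤ _ := by
        refine mul_le_mul_of_nonneg_right (mul_le_mul_of_nonneg_right
          (mul_le_mul_of_nonneg_left (two_mul_sq_le_laplaceConst h0 h1 hd) hM) (by positivity)) hF

theorem exp_neg_le_deficit_div {α : ℝ} (h0 : 0 < α) (h1 : α < 1) (hd : 2 ≤ d) {r : ℝ}
    (hr : 0 ≤ r) : Real.exp (-r) ≤ deficit α d 0 r / deficit α d 0 0 := by
  have hD1 := one_le_mul_deficit_zero h0 h1 hd (prod_one_add_pow_le h0 h1)
  have hD0 : 0 < deficit α d 0 0 := by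
    refine lt_of_le_of_ne (deficit_nonneg h0 hd 0 0) fun h => ?_
    rw [← h] at hD1
    norm_num at hD1
  rw [le_div_iff₀ hD0]
  exact exp_neg_mul_deficit_zero_le h0 hd hr

theorem deficit_div_of_nonpos {α : ℝ} (h0 : 0 < α) (h1 : α < 1) (hd : 2 ≤ d) {r : ℝ}
    (hr : r ≤ 0) : deficit α d 0 r / deficit α d 0 0 = Real.exp (d * r) := by
  have hD1 := one_le_mul_deficit_zero h0 h1 hd (prod_one_add_pow_le h0 h1)
  have hD0 : deficit α d 0 0 ≠ 0 := fun h => by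
    rw [h] at hD1
    norm_num at hD1
  rw [deficit_zero_of_nonpos hd hr, mul_div_cancel_right₀ _ hD0]

/-- Given that the root gets wet at time `a`, percolation survives time `r` exactly if it survives
the time `(r - a) / α` in each of the `d` subtrees above the children. -/
theorem hitProb_nil {α : ℝ} (h0 : 0 < α) {W : Set ℝ} (hW : MeasurableSet W) (r : ℝ) :
    hitProb α W ([] : Vertex d) r =
      ∫⁻ a in {a | a - r ∈ W}, weightLaw d (surviving α ((r - a) / α)) ^ d ∂expMeasure 1 := by
  have hW' : MeasurableSet {a : ℝ | a - r ∈ W} := hW.preimage (by fun_prop)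
  have hE : MeasurableSet {u : Vertex d → ℝ | passageTime α u [] - r ∈ W ∧ u ∈ surviving α r} :=
    (((measurable_passageTime α []).sub_const r) hW).inter (measurableSet_surviving α r)
  rw [hitProb, weightLaw_apply hE, ← lintegral_indicator hW']
  refine lintegral_congr_ae ?_
  filter_upwards [ae_ae_graft_pos (d := d)] with a ha
  by_cases haW : a - r ∈ W
  · rw [Set.indicator_of_mem (by exact haW)]
    have hE' : {v | graft (a, v) ∈ {u : Vertex d → ℝ | passageTime α u [] - r ∈ W ∧
        u ∈ surviving α r}} =ᵐ[Measure.pi fun _ : Fin d => weightLaw d]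
        Set.pi Set.univ fun _ : Fin d => surviving α ((r - a) / α) := by
      refine eventuallyEq_set.2 ?_
      filter_upwards [ha] with v hv
      rw [passageTime_nil, graft_mem_surviving h0 r a v hv]
      simpa [graft, Set.mem_pi] using fun _ => haW
    refine (measure_congr hE').trans ?_
    rw [Measure.pi_pi]
    simp
  · rw [Set.indicator_of_notMem (by exact haW)]
    refine measure_mono_null (fun v hv => ?_) measure_empty
    exact haW (by simpa [passageTime_nil, graft] using hv.1)

theorem hitProb_nil_Icc_le {α : ℝ} (h0 : 0 < α) (h1 : α < 1) (hd : 2 ≤ d) {δ : ℝ}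
    (hδ : 0 ≤ δ) (r : ℝ) :
    hitProb α (Set.Icc (-δ) 0) ([] : Vertex d) r ≤
      ENNReal.ofReal (tailConst α d ^ d * min α δ * (deficit α d 0 r / deficit α d 0 0)) := by
  have hc := one_le_tailConst (α := α) h0 h1 hd
  have hset : {a : ℝ | a - r ∈ Set.Icc (-δ) 0} = Set.Icc (r - δ) r := by
    ext a
    simp only [Set.mem_ofPred_eq, Set.mem_Icc]
    constructor <;> rintro ⟨_, _⟩ <;> constructor <;> linarith
  rw [hitProb_nil h0 measurableSet_Icc, hset]
  rcases lt_or_ge r 0 with hr | hr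
  · have : expMeasure 1 (Set.Icc (r - δ) r) = 0 :=
      measure_mono_null (fun a ha => (ha.2.trans hr.le : a ≤ 0)) expMeasure_Iic_zero
    rw [Measure.restrict_eq_zero.2 this, lintegral_zero_measure]
    exact zero_le
  have hpt : ∀ a ∈ Set.Icc (r - δ) r,
      ENNReal.ofReal (Real.exp (-a)) * weightLaw d (surviving α ((r - a) / α)) ^ d ≤
        ENNReal.ofReal (tailConst α d ^ d * Real.exp (-r) * Real.exp (α⁻¹ * (a - r))) :=
    fun a ha => by
      rw [← ofReal_survival, ← ENNReal.ofReal_pow (survival_nonneg _ _ _),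
        ← ENNReal.ofReal_mul (Real.exp_pos _).le]
      refine ENNReal.ofReal_le_ofReal ?_
      have h2 := pow_le_pow_left₀ (survival_nonneg _ _ _)
        (survival_le_tailConst_mul h0 h1 hd ((r - a) / α)) d
      refine (mul_le_mul_of_nonneg_left h2 (Real.exp_pos _).le).trans ?_
      rw [mul_pow, ← Real.exp_nat_mul, mul_left_comm, ← Real.exp_add, mul_assoc, ← Real.exp_add]
      refine mul_le_mul_of_nonneg_left (Real.exp_le_exp.2 ?_) (by positivity)
      have hd2 : (2 : ℝ) ≤ d := by exact_mod_cast hd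
      have h3 : 0 ≤ (r - a) / α := div_nonneg (by linarith [ha.2]) h0.le
      have h4 : r - a ≤ (r - a) / α := by
        rw [le_div_iff₀ h0]
        nlinarith [ha.2]
      have h5 : α⁻¹ * (a - r) = -((r - a) / α) := by
        field_simp
        ring
      rw [h5]
      nlinarith
  have hmeas : Measurable fun a => weightLaw d (surviving α ((r - a) / α)) ^ d := by
    simp only [← ofReal_survival]
    exact ((measurable_survival_comp α d (by fun_prop)).ennreal_ofReal).pow_const d
  have hexp := exp_neg_le_deficit_div h0 h1 hd hr
  have hle : ∫⁻ a in Set.Icc (r - δ) r, weightLaw d (surviving α ((r - a) / α)) ^ d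
        ∂expMeasure 1 ≤
      ∫⁻ a in Set.Icc (r - δ) r,
        ENNReal.ofReal (tailConst α d ^ d * Real.exp (-r) * Real.exp (α⁻¹ * (a - r))) := by
    rw [← lintegral_indicator measurableSet_Icc,
      lintegral_expMeasure_one _ (hmeas.indicator measurableSet_Icc),
      ← lintegral_indicator measurableSet_Icc]
    refine (setLIntegral_le_lintegral _ _).trans (lintegral_mono fun a => ?_)
    by_cases ha : a ∈ Set.Icc (r - δ) r
    · simp only [Set.indicator_of_mem ha]
      exact hpt a ha
    · simp [Set.indicator_of_notMem ha]
  refine hle.trans ?_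
  rw [show tailConst α d ^ d * min α δ * (deficit α d 0 r / deficit α d 0 0) =
    min (tailConst α d ^ d * (deficit α d 0 r / deficit α d 0 0) * α)
      (tailConst α d ^ d * (deficit α d 0 r / deficit α d 0 0) * δ) by
    rw [← mul_min_of_nonneg _ _ (mul_nonneg (by positivity) ((Real.exp_pos _).le.trans hexp))]
    ring]
  have hmul : ∀ z, 0 ≤ z → tailConst α d ^ d * Real.exp (-r) * z ≤
      tailConst α d ^ d * (deficit α d 0 r / deficit α d 0 0) * z := fun z hz => by
    gcongr
  have hk : 0 < α⁻¹ := inv_pos.2 h0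
  rw [ENNReal.ofReal_min]
  refine le_min ?_ ?_
  · have hsplit : ∀ a, Real.exp (α⁻¹ * (a - r)) =
        Real.exp (α⁻¹ * a) * Real.exp (-(α⁻¹ * r)) := fun a => by
      rw [← Real.exp_add]
      congr 1
      ring
    have hI : IntegrableOn (fun a => tailConst α d ^ d * Real.exp (-r) *
        Real.exp (α⁻¹ * (a - r))) (Set.Iic r) := by
      simp only [hsplit]
      exact ((integrableOn_exp_mul_Iic hk r).mul_const _).const_mul _
    refine (lintegral_mono_set Set.Icc_subset_Iic_self).trans ?_
    rw [← ofReal_integral_eq_lintegral_ofReal hI (Eventually.of_forall fun a => by positivity)]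
    refine ENNReal.ofReal_le_ofReal (le_trans (le_of_eq ?_) (hmul α h0.le))
    rw [integral_const_mul]
    congr 1
    simp only [hsplit]
    rw [integral_mul_const, integral_exp_mul_Iic hk, div_mul_eq_mul_div, ← Real.exp_add,
      add_neg_cancel, Real.exp_zero, one_div, inv_inv]
  · calc _ ≤ ∫⁻ a in Set.Icc (r - δ) r, ENNReal.ofReal (tailConst α d ^ d * Real.exp (-r)) := by
          refine setLIntegral_mono measurable_const fun a ha => ENNReal.ofReal_le_ofReal ?_
          refine mul_le_of_le_one_right (by positivity) (Real.exp_le_one_iff.2 ?_)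
          exact mul_nonpos_of_nonneg_of_nonpos hk.le (by linarith [ha.2])
      _ = ENNReal.ofReal (tailConst α d ^ d * Real.exp (-r) * δ) := by
          rw [setLIntegral_const, Real.volume_Icc, ← ENNReal.ofReal_mul (by positivity)]
          congr 2
          ring
      _ ≤ _ := ENNReal.ofReal_le_ofReal (hmul δ hδ)

theorem expMeasure_Ioc_le (a b : ℝ) :
    expMeasure 1 (Set.Ioc a b) ≤ ENNReal.ofReal (Real.exp (-a) * (b - a)) := by
  rw [expMeasure_eq, withDensity_apply _ measurableSet_Ioc]
  calc ∫⁻ y in Set.Ioc a b, exponentialPDF 1 y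
      ≤ ∫⁻ _ in Set.Ioc a b, ENNReal.ofReal (Real.exp (-a)) := by
        refine setLIntegral_mono measurable_const fun y hy => ?_
        rw [exponentialPDF_eq]
        refine ENNReal.ofReal_le_ofReal ?_
        split_ifs
        · rw [one_mul, one_mul]
          exact Real.exp_le_exp.2 (by linarith [hy.1])
        · positivity
    _ = _ := by
        rw [setLIntegral_const, Real.volume_Ioc, ENNReal.ofReal_mul (Real.exp_pos _).le]

theorem hitProb_nil_Ioc_le {α : ℝ} (h0 : 0 < α) (h1 : α < 1) (hd : 2 ≤ d) {δ : ℝ}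
    (hδ : 0 ≤ δ) (r : ℝ) :
    hitProb α (Set.Ioc 0 δ) ([] : Vertex d) r ≤
      ENNReal.ofReal (δ * Real.exp ((d + 1) * δ) * (deficit α d 0 r / deficit α d 0 0)) := by
  have hset : {a : ℝ | a - r ∈ Set.Ioc 0 δ} = Set.Ioc r (r + δ) := by
    ext a
    simp only [Set.mem_ofPred_eq, Set.mem_Ioc]
    constructor <;> rintro ⟨_, _⟩ <;> constructor <;> linarith
  have hle : hitProb α (Set.Ioc 0 δ) ([] : Vertex d) r ≤ expMeasure 1 (Set.Ioc r (r + δ)) := by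
    rw [hitProb_nil h0 measurableSet_Ioc, hset]
    calc _ ≤ ∫⁻ a in Set.Ioc r (r + δ), 1 ∂expMeasure 1 :=
          lintegral_mono fun a => pow_le_one' prob_le_one d
      _ = _ := by simp
  refine hle.trans ?_
  have hd0 : (0 : ℝ) < d := by exact_mod_cast (by omega : 0 < d)
  rcases lt_or_ge (r + δ) 0 with hr | hr
  · have : expMeasure 1 (Set.Ioc r (r + δ)) = 0 :=
      measure_mono_null (fun a ha => (ha.2.trans hr.le : a ≤ 0)) expMeasure_Iic_zero
    rw [this]
    exact zero_le
  refine (expMeasure_Ioc_le r (r + δ)).trans (ENNReal.ofReal_le_ofReal ?_)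
  rw [add_sub_cancel_left, mul_comm (Real.exp (-r)), mul_assoc]
  refine mul_le_mul_of_nonneg_left ?_ hδ
  rcases le_total 0 r with hr0 | hr0
  · refine (exp_neg_le_deficit_div h0 h1 hd hr0).trans (le_mul_of_one_le_left ?_ ?_)
    · exact (Real.exp_pos _).le.trans (exp_neg_le_deficit_div h0 h1 hd hr0)
    · exact Real.one_le_exp (by positivity)
  · rw [deficit_div_of_nonpos h0 h1 hd hr0, ← Real.exp_add]
    refine Real.exp_le_exp.2 ?_
    nlinarith

/-! ### Counting vertices level by level -/

/-- The vertices at distance `n` from the root, as a finite set. -/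
def levelFinset (d n : ℕ) : Finset (Vertex d) :=
  (Finset.univ : Finset (List.Vector (Fin d) n)).map
    ⟨List.Vector.toList, List.Vector.toList_injective⟩

theorem mem_levelFinset {n : ℕ} {x : Vertex d} : x ∈ levelFinset d n ↔ x.length = n := by
  simp only [levelFinset, Finset.mem_map, Finset.mem_univ, true_and, Function.Embedding.coeFn_mk]
  exact ⟨fun ⟨v, hv⟩ => hv ▸ v.toList_length, fun h => ⟨⟨x, h⟩, rfl⟩⟩

theorem card_levelFinset (d n : ℕ) : (levelFinset d n).card = d ^ n := by
  rw [levelFinset, Finset.card_map, Finset.card_univ, card_vector, Fintype.card_fin]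

theorem size_inter_level (A : Set (Vertex d)) (n : ℕ) :
    size (A ∩ level d n) = ∑ x ∈ levelFinset d n, A.indicator 1 x := by
  classical
  have h : A ∩ level d n = ↑((levelFinset d n).filter (· ∈ A)) := by
    ext x
    simp [level, mem_levelFinset, and_comm]
  rw [size, h, Set.encard_coe_eq_coe_finsetCard]
  simp [Set.indicator_apply]

theorem size_mono {A B : Set (Vertex d)} (h : A ⊆ B) : size A ≤ size B :=
  ENat.toENNReal_le.2 (Set.encard_le_encard h)

theorem size_eq_tsum (A : Set (Vertex d)) : size A = ∑' n, size (A ∩ level d n) := by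
  have h1 : ∀ B : Set (Vertex d), size B = ∑' x, B.indicator 1 x := fun B => by
    rw [size, ← ENNReal.tsum_set_one, tsum_subtype B (fun _ => (1 : ENNReal))]
    rfl
  simp_rw [h1]
  rw [ENNReal.tsum_comm]
  refine tsum_congr fun x => ?_
  rw [tsum_eq_single x.length fun n hn => Set.indicator_of_notMem (fun h => hn h.2.symm) _]
  by_cases hx : x ∈ A
  · rw [Set.indicator_of_mem hx,
      Set.indicator_of_mem (show x ∈ A ∩ level d x.length from ⟨hx, rfl⟩)]
  · rw [Set.indicator_of_notMem hx,
      Set.indicator_of_notMem fun h : x ∈ A ∩ level d x.length => hx h.1]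

/-- The number of vertices of level `n` that get wet at a time in the window `t + W`. -/
def windowCount (α : ℝ) (W : Set ℝ) (n : ℕ) (t : ℝ) (u : Vertex d → ℝ) : ENNReal :=
  size ({x | passageTime α u x - t ∈ W} ∩ level d n)

theorem windowCount_eq (α : ℝ) (W : Set ℝ) (n : ℕ) (t : ℝ) :
    (windowCount α W n t : (Vertex d → ℝ) → ENNReal) = fun u =>
      ∑ x ∈ levelFinset d n, {u | passageTime α u x - t ∈ W}.indicator 1 u := by
  ext u
  rw [windowCount, size_inter_level]
  rfl

theorem measurableSet_window (α : ℝ) {W : Set ℝ} (hW : MeasurableSet W) (t : ℝ) (x : Vertex d) :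
    MeasurableSet {u : Vertex d → ℝ | passageTime α u x - t ∈ W} :=
  ((measurable_passageTime α x).sub_const t) hW

theorem measurable_windowCount (α : ℝ) {W : Set ℝ} (hW : MeasurableSet W) (n : ℕ) (t : ℝ) :
    Measurable (windowCount α W n t : (Vertex d → ℝ) → ENNReal) := by
  rw [windowCount_eq]
  exact Finset.measurable_sum _ fun x _ =>
    measurable_one.indicator (measurableSet_window α hW t x)

/-- The sum of `hitProb_le` over the `d ^ n` vertices of level `n`. -/
theorem setLIntegral_windowCount_le {α : ℝ} (h0 : 0 < α) (h1 : α < 1) (hd : 2 ≤ d) {M : ℝ}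
    (hM : 0 ≤ M) (n : ℕ) {W : Set ℝ} (hW : MeasurableSet W)
    (hbase : ∀ r, hitProb α ((fun w => α ^ n * w) ⁻¹' W) ([] : Vertex d) r ≤
      ENNReal.ofReal (M * (deficit α d 0 r / deficit α d 0 0))) (t : ℝ) :
    ∫⁻ u in surviving α t, windowCount α W n t u ∂weightLaw d ≤
      ENNReal.ofReal (M * laplaceConst α (d - α) d * α ^ n * survival α d t) := by
  have hlev : ∀ x ∈ levelFinset d n, (d : ENNReal) ^ n * hitProb α W x t ≤
      ENNReal.ofReal (M * laplaceConst α (d - α) d * α ^ n * survival α d t) := fun x hx => by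
    obtain rfl := mem_levelFinset.1 hx
    exact hitProb_le h0 h1 hd hM x hW hbase t
  have hd0 : (d : ENNReal) ^ n ≠ 0 := pow_ne_zero _ (by exact_mod_cast (by omega : d ≠ 0))
  have hdt : (d : ENNReal) ^ n ≠ ⊤ := ENNReal.pow_ne_top (ENNReal.natCast_ne_top d)
  rw [windowCount_eq, lintegral_finsetSum _ fun x _ =>
    measurable_one.indicator (measurableSet_window α hW t x)]
  calc ∑ x ∈ levelFinset d n, ∫⁻ u in surviving α t,
        {u | passageTime α u x - t ∈ W}.indicator 1 u ∂weightLaw d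
      = ∑ x ∈ levelFinset d n, hitProb α W x t := by
        refine Finset.sum_congr rfl fun x _ => ?_
        rw [lintegral_indicator_one (measurableSet_window α hW t x),
          Measure.restrict_apply (measurableSet_window α hW t x)]
        rfl
    _ ≤ ∑ x ∈ levelFinset d n,
        ENNReal.ofReal (M * laplaceConst α (d - α) d * α ^ n * survival α d t) /
          (d : ENNReal) ^ n := by
        refine Finset.sum_le_sum fun x hx => ?_
        rw [ENNReal.le_div_iff_mul_le (Or.inl hd0) (Or.inl hdt), mul_comm]
        exact hlev x hx
    _ = _ := by
        rw [Finset.sum_const, card_levelFinset, nsmul_eq_mul, Nat.cast_pow,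
          ENNReal.mul_div_cancel hd0 hdt]

theorem laplaceConst_nonneg {α : ℝ} (h0 : 0 < α) (h1 : α < 1) (hd : 2 ≤ d) :
    0 ≤ laplaceConst α (d - α) d :=
  le_trans (by positivity) (two_mul_sq_le_laplaceConst (d := d) h0 h1 hd)

theorem levelConst_nonneg {α : ℝ} (h0 : 0 < α) (h1 : α < 1) (hd : 2 ≤ d) :
    0 ≤ levelConst α d := by
  have h2 := one_le_tailConst (α := α) h0 h1 hd
  exact mul_nonneg (by positivity) (laplaceConst_nonneg h0 h1 hd)

theorem preimage_mul_Icc {a : ℝ} (ha : 0 < a) (δ : ℝ) :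
    (fun w => a * w) ⁻¹' Set.Icc (-δ) 0 = Set.Icc (-(δ / a)) 0 := by
  rw [Set.preimage_const_mul_Icc₀ _ _ ha, neg_div, zero_div]

theorem preimage_mul_Ioc {a : ℝ} (ha : 0 < a) (δ : ℝ) :
    (fun w => a * w) ⁻¹' Set.Ioc 0 δ = Set.Ioc 0 (δ / a) := by
  rw [Set.preimage_const_mul_Ioc₀ _ _ ha, zero_div]

theorem setLIntegral_windowCount_Icc_le {α : ℝ} (h0 : 0 < α) (h1 : α < 1) (hd : 2 ≤ d) {δ : ℝ}
    (hδ : 0 ≤ δ) (n : ℕ) (t : ℝ) :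
    ∫⁻ u in surviving α t, windowCount α (Set.Icc (-δ) 0) n t u ∂weightLaw d ≤
      ENNReal.ofReal (levelConst α d * min (α ^ (n + 1)) δ * survival α d t) := by
  have hαn := pow_pos h0 n
  have hc := one_le_tailConst (α := α) h0 h1 hd
  refine (setLIntegral_windowCount_le h0 h1 hd (M := tailConst α d ^ d * min α (δ / α ^ n))
    (by positivity) n measurableSet_Icc (fun r => ?_) t).trans_eq ?_
  · rw [preimage_mul_Icc hαn]
    exact hitProb_nil_Icc_le h0 h1 hd (by positivity) r
  · have hmin : min (α ^ (n + 1)) δ = min α (δ / α ^ n) * α ^ n := by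
      rw [min_mul_of_nonneg _ _ hαn.le, div_mul_cancel₀ _ hαn.ne', pow_succ']
    rw [hmin, levelConst]
    congr 1
    ring

/-! ### The sum over the levels -/

theorem sum_pow_le {α : ℝ} (h0 : 0 < α) (h1 : α < 1) (N : ℕ) :
    ∑ n ∈ Finset.range N, α ^ n ≤ (1 - α)⁻¹ := by
  rw [← tsum_geometric_of_lt_one h0.le h1]
  exact (summable_geometric_of_lt_one h0.le h1).sum_le_tsum _ fun n _ => by positivity

/-- About `log⁺ (1 / δ) / (1 - α)` levels contribute `δ` each; the rest is a geometric series. -/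
theorem sum_min_pow_le {α : ℝ} (h0 : 0 < α) (h1 : α < 1) {δ : ℝ} (hδ : 0 ≤ δ) (N : ℕ) :
    ∑ n ∈ Finset.range N, min (α ^ (n + 1)) δ ≤
      (1 - α)⁻¹ * (Real.posLog (1 / δ) + 1) * min δ 1 := by
  have hα : 0 < 1 - α := by linarith
  rcases hδ.eq_or_lt with rfl | hδ
  · simp only [min_eq_left zero_le_one, mul_zero]
    exact Finset.sum_nonpos fun n _ => min_le_right _ _
  rcases le_or_gt 1 δ with hδ1 | hδ1
  · rw [min_eq_right hδ1, mul_one]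
    calc ∑ n ∈ Finset.range N, min (α ^ (n + 1)) δ ≤ ∑ n ∈ Finset.range N, α ^ n :=
          Finset.sum_le_sum fun n _ => (min_le_left _ _).trans
            (pow_le_pow_of_le_one h0.le h1.le n.le_succ)
      _ ≤ (1 - α)⁻¹ := sum_pow_le h0 h1 N
      _ ≤ _ := le_mul_of_one_le_right (inv_nonneg.2 hα.le)
          (le_add_of_nonneg_left Real.posLog_nonneg)
  · rw [min_eq_left hδ1.le]
    have hex : ∃ k : ℕ, α ^ (k + 1) ≤ δ := by
      obtain ⟨k, hk⟩ := exists_pow_lt_of_lt_one hδ h1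
      exact ⟨k, (pow_le_pow_of_le_one h0.le h1.le k.le_succ).trans hk.le⟩
    -- levels below `k` contribute `δ` each, the others a geometric series starting below `δ`
    obtain ⟨k, hk, hkmin⟩ : ∃ k : ℕ, α ^ (k + 1) ≤ δ ∧ ∀ m < k, ¬ α ^ (m + 1) ≤ δ := by
      classical
      exact ⟨Nat.find hex, Nat.find_spec hex, fun m hm => Nat.find_min hex hm⟩
    have hlog : (k : ℝ) * (1 - α) ≤ Real.posLog (1 / δ) := by
      rcases k with _ | k
      · simpa using Real.posLog_nonneg
      have h2 := Real.log_le_log hδ (not_le.1 (hkmin k k.lt_succ_self)).le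
      rw [Real.log_pow] at h2
      have h3 := Real.log_le_sub_one_of_pos h0
      have h4 : Real.log (1 / δ) ≤ Real.posLog (1 / δ) := le_max_right _ _
      rw [one_div, Real.log_inv] at h4
      have h5 : (0 : ℝ) ≤ ((k + 1 : ℕ) : ℝ) := by positivity
      rw [one_div]
      nlinarith
    calc ∑ n ∈ Finset.range N, min (α ^ (n + 1)) δ
        ≤ ∑ n ∈ Finset.range (k + N), min (α ^ (n + 1)) δ :=
          Finset.sum_le_sum_of_subset_of_nonneg
            (Finset.range_mono (Nat.le_add_left N k)) fun n _ _ => by positivity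
      _ = ∑ n ∈ Finset.range k, min (α ^ (n + 1)) δ +
          ∑ n ∈ Finset.range N, min (α ^ (k + n + 1)) δ := Finset.sum_range_add _ _ _
      _ ≤ ∑ n ∈ Finset.range k, δ + ∑ n ∈ Finset.range N, α ^ n * δ := by
          gcongr with n _ n _
          · exact min_le_right _ _
          · refine (min_le_left _ _).trans ?_
            rw [show k + n + 1 = n + (k + 1) by ring, pow_add]
            gcongr
      _ ≤ k * δ + (1 - α)⁻¹ * δ := by
          rw [Finset.sum_const, Finset.card_range, nsmul_eq_mul, ← Finset.sum_mul]
          gcongr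
          exact sum_pow_le h0 h1 N
      _ ≤ _ := by
          rw [← add_mul]
          refine mul_le_mul_of_nonneg_right ?_ hδ.le
          rw [mul_add, mul_one, add_le_add_iff_right, inv_mul_eq_div, le_div_iff₀ hα]
          exact hlog

theorem posLog_add_one_mul_le {δ : ℝ} (hδ : 0 ≤ δ) :
    (Real.posLog (1 / δ) + 1) * min δ 1 ≤ 1 := by
  rcases hδ.eq_or_lt with rfl | hδ
  · simp
  rcases le_or_gt 1 δ with hδ1 | hδ1
  · rw [min_eq_right hδ1, (Real.posLog_eq_zero_iff _).2]
    · simp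
    · rw [abs_of_pos (by positivity)]
      exact (div_le_one hδ).2 hδ1
  · have h1 : (1 : ℝ) ≤ 1 / δ := by rw [le_div_iff₀ hδ]; linarith
    rw [min_eq_left hδ1.le, Real.posLog_eq_log (by rwa [abs_of_pos (by positivity)])]
    have h2 := Real.log_le_sub_one_of_pos (show 0 < 1 / δ by positivity)
    calc (Real.log (1 / δ) + 1) * δ ≤ (1 / δ) * δ := by
          refine mul_le_mul_of_nonneg_right ?_ hδ.le
          linarith
      _ = 1 := by field_simp

theorem tsum_levelConst_mul_le {α : ℝ} (h0 : 0 < α) (h1 : α < 1) (hd : 2 ≤ d) {δ : ℝ}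
    (hδ : 0 ≤ δ) :
    ∑' n : ℕ, ENNReal.ofReal (levelConst α d * min (α ^ (n + 1)) δ) ≤
      ENNReal.ofReal (levelConst α d * (1 - α)⁻¹ * (Real.posLog (1 / δ) + 1) * min δ 1) := by
  have hL := levelConst_nonneg h0 h1 hd
  refine ENNReal.tsum_le_of_sum_range_le fun N => ?_
  rw [← ENNReal.ofReal_sum_of_nonneg fun n _ => by positivity, ← Finset.mul_sum]
  refine ENNReal.ofReal_le_ofReal ?_
  rw [mul_assoc, mul_assoc, ← mul_assoc (1 - α)⁻¹]
  exact mul_le_mul_of_nonneg_left (sum_min_pow_le h0 h1 hδ N) hL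

/-! ### Vertices wet before the explosion -/

/-- Before the explosion, each vertex of level `n` that is wet by time `m * δ` gets wet in some
window `(i * δ, (i + 1) * δ]` at whose beginning percolation has not reached infinity. -/
theorem size_le_sum_windowCount {α : ℝ} (h0 : 0 < α) {u : Vertex d → ℝ} (hu : ∀ x, 0 < u x)
    (hexp : ∀ t : ℝ, (t : EReal) < explosionTime α u ↔ u ∈ surviving α t) {δ : ℝ}
    (m n : ℕ) :
    size (cluster α u (min ((m * δ : ℝ) : EReal) (explosionTime α u)) ∩ level d n) ≤
      ∑ i ∈ Finset.range m, (surviving α (i * δ)).indicator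
        (windowCount α (Set.Ioc 0 δ) n (i * δ)) u := by
  have hsum : ∀ i : ℕ, (surviving α (i * δ)).indicator
        (windowCount α (Set.Ioc 0 δ) n (i * δ)) u =
      ∑ x ∈ levelFinset d n, {x | u ∈ surviving α (i * δ) ∧
        passageTime α u x - i * δ ∈ Set.Ioc 0 δ}.indicator 1 x := fun i => by
    by_cases hi : u ∈ surviving α (i * δ)
    · simp only [Set.indicator_of_mem hi, hi, true_and]
      exact size_inter_level _ _
    · simp [hi]
  simp_rw [hsum]
  rw [Finset.sum_comm, size_inter_level]
  refine Finset.sum_le_sum fun x _ => ?_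
  by_cases hx : x ∈ cluster α u (min ((m * δ : ℝ) : EReal) (explosionTime α u))
  swap
  · rw [Set.indicator_of_notMem hx]
    exact zero_le
  obtain ⟨hx1, hx2⟩ := le_min_iff.1 (show (passageTime α u x : EReal) ≤ _ from hx)
  have hx1 : passageTime α u x ≤ m * δ := EReal.coe_le_coe_iff.1 hx1
  have hpos := passageTime_pos h0 hu x
  classical
  have hex : ∃ k : ℕ, passageTime α u x ≤ k * δ := ⟨m, hx1⟩
  obtain ⟨k, hk, hkmin⟩ : ∃ k : ℕ, passageTime α u x ≤ k * δ ∧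
      ∀ j < k, ¬ passageTime α u x ≤ j * δ :=
    ⟨Nat.find hex, Nat.find_spec hex, fun j hj => Nat.find_min hex hj⟩
  rcases k with _ | i
  · simp only [Nat.cast_zero, zero_mul] at hk
    linarith
  have hi := not_le.1 (hkmin i i.lt_succ_self)
  have him : i < m := by
    by_contra! h
    exact hkmin m (by omega) hx1
  rw [Set.indicator_of_mem hx]
  refine le_trans (le_of_eq ?_) (Finset.single_le_sum (fun _ _ => zero_le)
    (Finset.mem_range.2 him))
  rw [Set.indicator_of_mem]
  refine ⟨(hexp _).1 ((EReal.coe_lt_coe_iff.2 hi).trans_le hx2), by linarith, ?_⟩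
  push_cast at hk
  linarith

theorem sum_mul_exp_neg_le {δ : ℝ} (m : ℕ) :
    ∑ i ∈ Finset.range m, δ * Real.exp (-(i * δ)) ≤ Real.exp δ * (1 - Real.exp (-(m * δ))) := by
  have h : ∀ i : ℕ, δ * Real.exp (-(i * δ)) ≤
      Real.exp δ * (Real.exp (-(i * δ)) - Real.exp (-((i + 1 : ℕ) * δ))) := fun i => by
    have h1 : Real.exp δ * Real.exp (-((i + 1 : ℕ) * δ)) = Real.exp (-(i * δ)) := by
      rw [← Real.exp_add]
      congr 1
      push_cast
      ring
    rw [mul_sub, h1, ← sub_one_mul]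
    refine mul_le_mul_of_nonneg_right ?_ (Real.exp_pos _).le
    linarith [Real.add_one_le_exp δ]
  refine (Finset.sum_le_sum fun i _ => h i).trans_eq ?_
  rw [← Finset.mul_sum, Finset.sum_range_sub' fun i : ℕ => Real.exp (-(i * δ))]
  simp

theorem lintegral_sum_windowCount_le {α : ℝ} (h0 : 0 < α) (h1 : α < 1) (hd : 2 ≤ d) {δ : ℝ}
    (hδ : 0 ≤ δ) (m n : ℕ) :
    ∫⁻ u, ∑ i ∈ Finset.range m, (surviving α (i * δ)).indicator
        (windowCount α (Set.Ioc 0 δ) n (i * δ)) u ∂weightLaw d ≤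
      ENNReal.ofReal (Real.exp ((d + 1) * (δ / α ^ n)) * Real.exp δ *
        (laplaceConst α (d - α) d * tailConst α d * (1 - Real.exp (-(m * δ))))) := by
  have hαn := pow_pos h0 n
  have hC := laplaceConst_nonneg h0 h1 hd
  have hc := one_le_tailConst (α := α) h0 h1 hd
  have hc0 : 0 ≤ tailConst α d := by linarith
  rw [lintegral_finsetSum _ fun i _ =>
    (measurable_windowCount α measurableSet_Ioc n _).indicator (measurableSet_surviving α _)]
  calc ∑ i ∈ Finset.range m, ∫⁻ u, (surviving α (i * δ)).indicator
          (windowCount α (Set.Ioc 0 δ) n (i * δ)) u ∂weightLaw d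
      ≤ ∑ i ∈ Finset.range m, ENNReal.ofReal (Real.exp ((d + 1) * (δ / α ^ n)) *
          laplaceConst α (d - α) d * tailConst α d * (δ * Real.exp (-(i * δ)))) := by
        refine Finset.sum_le_sum fun i _ => ?_
        rw [lintegral_indicator (measurableSet_surviving α _)]
        refine (setLIntegral_windowCount_le h0 h1 hd
          (M := δ / α ^ n * Real.exp ((d + 1) * (δ / α ^ n))) (by positivity) n
          measurableSet_Ioc (fun r => ?_) _).trans (ENNReal.ofReal_le_ofReal ?_)
        · rw [preimage_mul_Ioc hαn]
          exact hitProb_nil_Ioc_le h0 h1 hd (by positivity) r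
        · calc _ = Real.exp ((d + 1) * (δ / α ^ n)) * laplaceConst α (d - α) d * δ *
                survival α d (i * δ) := by
                field_simp
            _ ≤ Real.exp ((d + 1) * (δ / α ^ n)) * laplaceConst α (d - α) d * δ *
                (tailConst α d * Real.exp (-(i * δ))) :=
                mul_le_mul_of_nonneg_left (survival_le_tailConst_mul h0 h1 hd _) (by positivity)
            _ = _ := by ring
    _ = ENNReal.ofReal (Real.exp ((d + 1) * (δ / α ^ n)) *
          laplaceConst α (d - α) d * tailConst α d *
            ∑ i ∈ Finset.range m, δ * Real.exp (-(i * δ))) := by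
        rw [← ENNReal.ofReal_sum_of_nonneg fun i _ => by positivity, ← Finset.mul_sum]
    _ ≤ _ := by
        refine ENNReal.ofReal_le_ofReal ?_
        refine (mul_le_mul_of_nonneg_left (sum_mul_exp_neg_le m) (by positivity)).trans_eq ?_
        ring

theorem laplaceConst_mul_tailConst_le {α : ℝ} (h0 : 0 < α) (h1 : α < 1) (hd : 2 ≤ d) :
    laplaceConst α (d - α) d * tailConst α d ≤ clusterConst α d := by
  have hC := laplaceConst_nonneg h0 h1 hd
  have hc := one_le_tailConst (α := α) h0 h1 hd
  have h2 : tailConst α d ≤ tailConst α d ^ d := le_self_pow₀ hc (by omega)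
  have h3 : 1 ≤ (1 - α)⁻¹ := (one_le_inv₀ (by linarith)).2 (by linarith)
  calc laplaceConst α (d - α) d * tailConst α d ≤ tailConst α d ^ d * laplaceConst α (d - α) d := by
        rw [mul_comm]
        gcongr
    _ ≤ _ := le_mul_of_one_le_right (by positivity) h3

/-! ### Transfer to an arbitrary probability space -/

theorem map_weights {Ω : Type*} [MeasurableSpace Ω] {P : Measure Ω} [IsProbabilityMeasure P]
    {U : Vertex d → Ω → ℝ} (hmeas : ∀ x, Measurable (U x))
    (hlaw : ∀ x, P.map (U x) = expMeasure 1) (hindep : iIndepFun U P) :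
    P.map (fun ω x => U x ω) = weightLaw d := by
  rw [hindep.map_fun_eq_infinitePi_map hmeas]
  simp_rw [hlaw]
  rfl

/-- Integrals of a function of the weights are bounded through a measurable majorant, so that no
measurability of the function itself is needed. -/
theorem lintegral_comp_le {X Y : Type*} [MeasurableSpace X] [MeasurableSpace Y] {ν : Measure X}
    {V : X → Y} (hV : Measurable V) {f g : Y → ENNReal} (hg : Measurable g)
    (hfg : ∀ᵐ y ∂ν.map V, f y ≤ g y) : ∫⁻ x, f (V x) ∂ν ≤ ∫⁻ y, g y ∂ν.map V := by
  rw [lintegral_map hg hV]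
  exact lintegral_mono_ae (ae_of_ae_map hV.aemeasurable hfg)

/-- The law of the weights given that the explosion time exceeds `t`. -/
theorem map_cond_explosionTime {α : ℝ} (h0 : 0 < α) (hd : 2 ≤ d) {Ω : Type*} [MeasurableSpace Ω]
    {P : Measure Ω} {V : Ω → Vertex d → ℝ} (hV : Measurable V)
    (hP : P.map V = weightLaw d) (t : ℝ) :
    (cond P {ω | (t : EReal) < explosionTime α (V ω)}).map V =
      cond (weightLaw d) (surviving α t) := by
  have hS : MeasurableSet (surviving α t : Set (Vertex d → ℝ)) := measurableSet_surviving α t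
  have hae : {ω | (t : EReal) < explosionTime α (V ω)} =ᵐ[P] V ⁻¹' surviving α t := by
    refine eventuallyEq_set.2 ?_
    filter_upwards [ae_of_ae_map hV.aemeasurable (hP ▸ ae_lt_explosionTime_iff h0 (by omega))]
      with ω hω using hω t
  rw [ProbabilityTheory.cond, ProbabilityTheory.cond, Measure.map_smul, measure_congr hae,
    Measure.restrict_congr_set hae,
    ← Measure.restrict_map hV hS, ← Measure.map_apply hV hS, hP]

/-- A vertex wet at time `t` but not before time `s` gets wet in the window `[s, t]`. -/
theorem cluster_diff_subset {α : ℝ} (h0 : 0 < α) {u : Vertex d → ℝ} (hu : ∀ x, 0 < u x)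
    (t δ : ℝ) :
    cluster α u t \ clusterLeft α u (t - δ) ⊆
      {x | passageTime α u x - t ∈ Set.Icc (-δ) 0} := by
  rintro x ⟨hx1, hx2⟩
  have hx1 : passageTime α u x ≤ t := EReal.coe_le_coe_iff.1 hx1
  refine ⟨?_, by linarith⟩
  by_contra! h
  refine hx2 (Set.mem_biUnion (x := passageTime α u x)
    ⟨(passageTime_pos h0 hu x).le, by linarith⟩ ?_)
  exact le_refl (passageTime α u x : EReal)

theorem lintegral_cond_windowCount_le {α : ℝ} (h0 : 0 < α) (h1 : α < 1) (hd : 2 ≤ d) {δ : ℝ}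
    (hδ : 0 ≤ δ) (n : ℕ) (t : ℝ) :
    ∫⁻ u, windowCount α (Set.Icc (-δ) 0) n t u ∂cond (weightLaw d) (surviving α t) ≤
      ENNReal.ofReal (levelConst α d * min (α ^ (n + 1)) δ) := by
  have hF := survival_pos (d := d) h0 t
  have hne : weightLaw d (surviving α t) ≠ 0 := by
    rw [← ofReal_survival]
    exact (ENNReal.ofReal_pos.2 hF).ne'
  rw [ProbabilityTheory.cond, lintegral_smul_measure, smul_eq_mul]
  refine (mul_le_mul_right (setLIntegral_windowCount_Icc_le h0 h1 hd hδ n t) _).trans_eq ?_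
  have hL := levelConst_nonneg (d := d) h0 h1 hd
  rw [ENNReal.ofReal_mul (by positivity), ofReal_survival, mul_left_comm,
    ENNReal.inv_mul_cancel hne (measure_ne_top _ _), mul_one]

theorem ae_cond_weight_pos (α t : ℝ) :
    ∀ᵐ u ∂cond (weightLaw d) (surviving α t), ∀ x, 0 < u x :=
  cond_absolutelyContinuous.ae_le ae_weight_pos

theorem lintegral_size_level_le {α : ℝ} (h0 : 0 < α) (h1 : α < 1) (hd : 2 ≤ d) {Ω : Type*}
    [MeasurableSpace Ω] {P : Measure Ω} {V : Ω → Vertex d → ℝ} (hV : Measurable V)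
    (hP : P.map V = weightLaw d) {δ : ℝ} (hδ : 0 ≤ δ) (t : ℝ) (n : ℕ) :
    ∫⁻ ω, size ((cluster α (V ω) t \ clusterLeft α (V ω) (t - δ)) ∩ level d n)
        ∂cond P {ω | (t : EReal) < explosionTime α (V ω)} ≤
      ENNReal.ofReal (levelConst α d * min (α ^ (n + 1)) δ) := by
  have hmap := map_cond_explosionTime h0 hd hV hP t
  refine (lintegral_comp_le hV (measurable_windowCount α (measurableSet_Icc (a := -δ) (b := 0)) n t)
    (f := fun u => size ((cluster α u t \ clusterLeft α u (t - δ)) ∩ level d n)) ?_).trans ?_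
  · rw [hmap]
    filter_upwards [ae_cond_weight_pos α t] with u hu
    exact size_mono (Set.inter_subset_inter_left _ (cluster_diff_subset h0 hu t δ))
  · rw [hmap]
    exact lintegral_cond_windowCount_le h0 h1 hd hδ n t

theorem lintegral_size_le {α : ℝ} (h0 : 0 < α) (h1 : α < 1) (hd : 2 ≤ d) {Ω : Type*}
    [MeasurableSpace Ω] {P : Measure Ω} {V : Ω → Vertex d → ℝ} (hV : Measurable V)
    (hP : P.map V = weightLaw d) {δ : ℝ} (hδ : 0 ≤ δ) (t : ℝ) :
    ∫⁻ ω, size (cluster α (V ω) t \ clusterLeft α (V ω) (t - δ))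
        ∂cond P {ω | (t : EReal) < explosionTime α (V ω)} ≤
      ENNReal.ofReal (levelConst α d * (1 - α)⁻¹ * (Real.posLog (1 / δ) + 1) * min δ 1) := by
  have hmap := map_cond_explosionTime h0 hd hV hP t
  have hmeas := fun n => measurable_windowCount (d := d) α
    (measurableSet_Icc (a := -δ) (b := 0)) n t
  refine (lintegral_comp_le hV (f := fun u => size (cluster α u t \ clusterLeft α u (t - δ)))
    (g := fun u => ∑' n, windowCount α (Set.Icc (-δ) 0) n t u) (Measurable.tsum hmeas) ?_).trans ?_
  · rw [hmap]
    filter_upwards [ae_cond_weight_pos α t] with u hu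
    rw [size_eq_tsum]
    exact ENNReal.tsum_le_tsum fun n =>
      size_mono (Set.inter_subset_inter_left _ (cluster_diff_subset h0 hu t δ))
  · rw [hmap, lintegral_tsum fun n => (hmeas n).aemeasurable]
    exact (ENNReal.tsum_le_tsum fun n => lintegral_cond_windowCount_le h0 h1 hd hδ n t).trans
      (tsum_levelConst_mul_le h0 h1 hd hδ)

theorem lintegral_size_min_level_le {α : ℝ} (h0 : 0 < α) (h1 : α < 1) (hd : 2 ≤ d) {Ω : Type*}
    [MeasurableSpace Ω] {P : Measure Ω} {V : Ω → Vertex d → ℝ} (hV : Measurable V)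
    (hP : P.map V = weightLaw d) {t : ℝ} (ht : 0 ≤ t) (n : ℕ) :
    ∫⁻ ω, size (cluster α (V ω) (min (t : EReal) (explosionTime α (V ω))) ∩ level d n) ∂P ≤
      ENNReal.ofReal (clusterConst α d * (1 - Real.exp (-t))) := by
  -- discretize time into `m` windows of length `t / m` and let `m → ∞`
  set K := laplaceConst α (d - α) d * tailConst α d * (1 - Real.exp (-t)) with hK
  have hlim : Tendsto (fun m : ℕ => ENNReal.ofReal
      (Real.exp ((d + 1) * (t / m / α ^ n)) * Real.exp (t / m) * K)) atTop
      (𝓝 (ENNReal.ofReal K)) := by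
    have h2 : Tendsto (fun m : ℕ => t / (m : ℝ)) atTop (𝓝 0) :=
      tendsto_const_div_atTop_nhds_zero_nat t
    have h3 : Continuous fun s : ℝ => ENNReal.ofReal
        (Real.exp ((d + 1) * (s / α ^ n)) * Real.exp s * K) :=
      ENNReal.continuous_ofReal.comp (by fun_prop)
    simpa [Function.comp_def] using (h3.tendsto 0).comp h2
  refine (ge_of_tendsto hlim ?_).trans (ENNReal.ofReal_le_ofReal ?_)
  · filter_upwards [eventually_gt_atTop 0] with m hm
    have hmt : (m : ℝ) * (t / m) = t := by field_simp
    refine (lintegral_comp_le hV (f := fun u =>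
      size (cluster α u (min (t : EReal) (explosionTime α u)) ∩ level d n))
      (g := fun u => ∑ i ∈ Finset.range m, (surviving α (i * (t / m))).indicator
        (windowCount α (Set.Ioc 0 (t / m)) n (i * (t / m))) u) ?_ ?_).trans ?_
    · exact Finset.measurable_sum _ fun i _ =>
        (measurable_windowCount α measurableSet_Ioc n _).indicator (measurableSet_surviving α _)
    · rw [hP]
      filter_upwards [ae_weight_pos, ae_lt_explosionTime_iff h0 (by omega)] with u hu hexp
      have := size_le_sum_windowCount h0 hu hexp (δ := t / m) m n
      rwa [hmt] at this
    · rw [hP]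
      have := lintegral_sum_windowCount_le (d := d) h0 h1 hd (δ := t / m) (by positivity) m n
      rwa [hmt] at this
  · refine mul_le_mul_of_nonneg_right (laplaceConst_mul_tailConst_le h0 h1 hd) ?_
    simpa using ht

end TreeDLA

end

theorem theorem4p4 {Ω : Type*} [MeasurableSpace Ω] (P : Measure Ω) [IsProbabilityMeasure P]
    (d : ℕ) (hd : 2 ≤ d) (α : ℝ) (hα0 : 0 < α) (hα1 : α < 1)
    (U : TreeDLA.Vertex d → Ω → ℝ)
    (hmeas : ∀ x, Measurable (U x))
    (hlaw : ∀ x, P.map (U x) = expMeasure 1)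
    (hindep : iIndepFun U P) :
    -- the limit that defines the constant `tailConst α d` exists
    Tendsto (fun t : ℝ => Real.exp t *
        P.real {ω | (t : EReal) < TreeDLA.explosionTime α (fun x => U x ω)})
      atTop (𝓝 (TreeDLA.tailConst α d)) ∧
    -- (a)
    (∀ δ t : ℝ, 0 ≤ δ → δ ≤ t → ∀ n : ℕ,
      ∫⁻ ω, TreeDLA.size
          ((TreeDLA.cluster α (fun x => U x ω) (t : EReal) \
              TreeDLA.clusterLeft α (fun x => U x ω) (t - δ)) ∩ TreeDLA.level d n)
        ∂(cond P {ω | (t : EReal) < TreeDLA.explosionTime α (fun x => U x ω)})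
      ≤ ENNReal.ofReal (TreeDLA.levelConst α d * min (α ^ (n + 1)) δ)) ∧
    -- (b)
    (∀ δ t : ℝ, 0 ≤ δ → δ ≤ t →
      ∫⁻ ω, TreeDLA.size
          (TreeDLA.cluster α (fun x => U x ω) (t : EReal) \
              TreeDLA.clusterLeft α (fun x => U x ω) (t - δ))
        ∂(cond P {ω | (t : EReal) < TreeDLA.explosionTime α (fun x => U x ω)})
      ≤ ENNReal.ofReal (TreeDLA.levelConst α d * (1 - α)⁻¹ *
          (Real.posLog (1 / δ) + 1) * min δ 1) ∧
      TreeDLA.levelConst α d * (1 - α)⁻¹ * (Real.posLog (1 / δ) + 1) * min δ 1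
        ≤ TreeDLA.clusterConst α d) ∧
    (∀ t : ℝ, 0 ≤ t →
      ∫⁻ ω, TreeDLA.size (TreeDLA.cluster α (fun x => U x ω) (t : EReal))
        ∂(cond P {ω | (t : EReal) < TreeDLA.explosionTime α (fun x => U x ω)})
      ≤ ENNReal.ofReal (TreeDLA.clusterConst α d)) ∧
    -- (c)
    (∀ t : ℝ, 0 ≤ t → ∀ n : ℕ,
      ∫⁻ ω, TreeDLA.size
          (TreeDLA.cluster α (fun x => U x ω)
              (min (t : EReal) (TreeDLA.explosionTime α (fun x => U x ω))) ∩
            TreeDLA.level d n) ∂P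
      ≤ ENNReal.ofReal (TreeDLA.clusterConst α d * (1 - Real.exp (-t)))) := by
  have hV : Measurable fun ω x => U x ω := measurable_pi_lambda _ hmeas
  have hP := TreeDLA.map_weights hmeas hlaw hindep
  have hbound : ∀ δ : ℝ, 0 ≤ δ → TreeDLA.levelConst α d * (1 - α)⁻¹ *
      (Real.posLog (1 / δ) + 1) * min δ 1 ≤ TreeDLA.clusterConst α d := fun δ hδ => by
    rw [mul_assoc]
    refine mul_le_of_le_one_right (mul_nonneg (TreeDLA.levelConst_nonneg hα0 hα1 hd) ?_)
      (TreeDLA.posLog_add_one_mul_le hδ)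
    exact inv_nonneg.2 (by linarith)
  refine ⟨?_, fun δ t hδ _ n => TreeDLA.lintegral_size_level_le hα0 hα1 hd hV hP hδ t n,
    fun δ t hδ _ => ⟨TreeDLA.lintegral_size_le hα0 hα1 hd hV hP hδ t, hbound δ hδ⟩,
    fun t ht => ?_,
    fun t ht n => TreeDLA.lintegral_size_min_level_le hα0 hα1 hd hV hP ht n⟩
  · convert TreeDLA.tendsto_tailConst hα0 hα1 hd using 3 with t
    rw [TreeDLA.survival, measureReal_def, measureReal_def, ← hP,
      Measure.map_apply hV (TreeDLA.measurableSet_surviving α t)]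
    congr 1
    refine measure_congr (eventuallyEq_set.2 ?_)
    filter_upwards [ae_of_ae_map hV.aemeasurable
      (hP ▸ TreeDLA.ae_lt_explosionTime_iff hα0 (by omega))] with ω hω using hω t
  · refine le_trans ?_ ((TreeDLA.lintegral_size_le hα0 hα1 hd hV hP ht t).trans
      (ENNReal.ofReal_le_ofReal (hbound t ht)))
    simp [TreeDLA.clusterLeft]
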